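/- **Nonlinearity profile.** Let $g:\mathbb R\to\mathbb R$ be a strictly increasing odd $C^1$ function with $g(0)=g'(0)=0$, $s g'(s)^2/g(s)\to0$ as $s\to0$ and $1\in g(\mathbb R)$, and let $s_0\in(0,1]$ be such that $g(s_0)<1$ and $H(s)=\sqrt s\,g(\sqrt s)$ is strictly convex on $[0,s_0^2]$. For $r>0$ put $L(r)=\frac1r\sup_{s\in[0,s_0^2]}(rs-H(s))$, put $L(0)=0$, $\Lambda_H(s)=H(s)/(sH'(s))$, and for $s\ge 1/H'(s_0^2)$ $$\psi(s)=\frac1{H'(s_0^2)}+\int_{1/s}^{H'(s_0^2)}\frac{dv}{v^2\,(1-\Lambda_H((H')^{-1}(v)))}.$$ The inverse $\psi^{-1}$ of $\psi:[1/H'(s_0^2),\infty)\to[1/H'(s_0^2),\infty)$ is extended by the constant $1/H'(s_0^2)$ on $(-\infty,1/H'(s_0^2)]$, and the inverse $(H')^{-1}$ of $H':[0,s_0^2]\to[0,H'(s_0^2)]$ is extended by the constant $s_0^2$ on $[H'(s_0^2),\infty)$. Let $c_1,c_2>0$. For measurable functions $f,r$ on a measure space, say that $(f,r)$ satisfies (SG)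 if almost everywhere $fr\ge0$, $c_1g(|f|)\le|r|\le c_2g^{-1}(|f|)$ where $|f|\le1$, and $c_1|f|\le|r|\le c_2|f|$ where $|f|\ge1$. **Continuous setting.** Let $X$ be a real Hilbert space, $A:D(A)\to X$ densely defined and skew-adjoint, $B$ a bounded nonnegative selfadjoint operator on $X$, and $F:X\to X$ Lipschitz on bounded sets with $\langle u,BF(u)\rangle\ge0$ for all $u$. Let $(\Omega,\mu)$ be a probability space, $b\ge0$ a bounded measurable function on $\Omega$, and $U:L^2(\Omega,\mu)\to X$ a surjective isometry with $U^{-1}BUf=bf$. Put $\rho(f)=U^{-1}F(Uf)$; assume $\rho(0)=0$, $f\rho(f)\ge0$ a.e. for every $f\in L^2$, and (SG) for $(f,\rho(f))$ for every $f\in L^\infty$. Let $X_{1/2}$ be the range of $(1-A)^{-1/2}$ with its natural norm, $X_{-1/2}$ its dual with respect to the pivot space $X$; $A$ extends canonically to a bounded operator $X_{1/2}\to X_{-1/2}$. **Semi-discretization.** For $0<\Delta x<\Delta x_0$ let $X_{\Delta x}$ be a finite-dimensional space and $\tilde P_{\Delta x}:X_{\Delta x}\to X_{1/2}$ linear and injective;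 $X_{\Delta x}$ carries the Euclidean norm $\|v\|_{\Delta x}=\|\tilde P_{\Delta x}v\|_X$, and $P_{\Delta x}=\tilde P_{\Delta x}^*:X_{-1/2}\to X_{\Delta x}$ (so that $P_{\Delta x}\tilde P_{\Delta x}=\mathrm{id}$). Assume $\tilde P_{\Delta x}P_{\Delta x}u\to u$ in $X$ as $\Delta x\to0$ for every $u\in X$. Put $A_{\Delta x}=P_{\Delta x}A\tilde P_{\Delta x}$, $B_{\Delta x}=P_{\Delta x}B\tilde P_{\Delta x}$, $F_{\Delta x}(v)=P_{\Delta x}F(\tilde P_{\Delta x}v)$. Let $\sigma>0$ and let $\mathcal V_{\Delta x}$ be nonnegative selfadjoint operators on $X_{\Delta x}$ with $\langle v,B_{\Delta x}F_{\Delta x}(v)\rangle_{\Delta x}+(\Delta x)^\sigma\|\mathcal V_{\Delta x}^{1/2}v\|_{\Delta x}^2\ge0$ for all $v$. Assume there are $\delta>0$ and $K$ with $(\Delta x)^\sigma\|\mathcal V_{\Delta x}^{1/2}\|^2\le K$ for all $\Delta x<\Delta x_0$, $\Delta x\le\delta$. Assume that for every $\Delta x\in(0,\Delta x_0)$ and $v\in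 X_{\Delta x}$ the pair $\big(U^{-1}\tilde P_{\Delta x}v,\;U^{-1}\tilde P_{\Delta x}P_{\Delta x}F(\tilde P_{\Delta x}v)\big)$ satisfies (SG). Write $E_v(t)=\frac12\|v(t)\|_{\Delta x}^2$. Finally assume the uniform observability inequality: there are $T>0$, $C_T>0$ such that, for every $\Delta x\in(0,\Delta x_0)$ and every solution of $\phi'+A_{\Delta x}\phi=0$ in $X_{\Delta x}$, $$C_TE_\phi(0)\le\int_0^T\Big(\|B_{\Delta x}^{1/2}\phi(t)\|_{\Delta x}^2+(\Delta x)^\sigma\|\mathcal V_{\Delta x}^{1/2}\phi(t)\|_{\Delta x}^2\Big)dt.$$ **Theorem.** There are constants $C,\kappa_1,\kappa_2,\kappa_3>0$ depending only on $g,s_0,c_1,c_2$ such that in every such situation, with $$\gamma_2=\kappa_2\,\frac{C_T}{T\,(T^2(\|B\|+K)^2+1)},\qquad \gamma_1=\kappa_1\frac{\|B\|}{\gamma_2},\qquad\gamma_3=\frac{\kappa_3}{\gamma_2},$$ the following holds. For every $\Delta x\in(0,\Delta x_0)$ and every initial datum in $X_{\Delta x}$, the equation $$u'+A_{\Delta x}u+B_{\Delta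 x}F_{\Delta x}(u)+(\Delta x)^\sigma\mathcal V_{\Delta x}u=0$$ has a solution on $[0,\infty)$, and every solution on an interval $[0,\tau)$ with the same initial datum coincides with it there. For every $\Delta x<\Delta x_0$ with $\Delta x\le\delta$, every solution $u$ on $[0,\infty)$ and every $t>0$, $$E_u(t)\le C\,\max(1,T)\,\max(\gamma_1,E_u(0))\,L\!\left(\frac1{\psi^{-1}(\gamma_2t)}\right).$$ If moreover $\limsup_{s\searrow0}\Lambda_H(s)<1$, then for the same $\Delta x$, $u$ and $t$, $$E_u(t)\le C\,\max(1,T)\,\max(\gamma_1,E_u(0))\,(H')^{-1}\!\left(\frac{\gamma_3}{t}\right).$$ -/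

import Mathlib

open Set Filter Topology MeasureTheory

noncomputable section

/-! ### The nonlinearity profile and the decay rate -/

/-- `H(s) = √s g(√s)`. -/
def dampingH (g : ℝ → ℝ) (s : ℝ) : ℝ := √s * g (√s)

/-- Standing assumptions on `g` and `s₀`. The last field says that `g⁻¹` is defined on `[0,1]`. -/
structure IsDampingProfile (g : ℝ → ℝ) (s₀ : ℝ) : Prop where
  contDiff : ContDiff ℝ 1 g
  strictMono : StrictMono g
  odd : ∀ s, g (-s) = -g s
  map_zero : g 0 = 0
  deriv_zero : deriv g 0 = 0
  tendsto_zero : Tendsto (fun s => s * (deriv g s) ^ 2 / g s) (𝓝[≠] 0) (𝓝 0)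
  pos : 0 < s₀
  le_one : s₀ ≤ 1
  map_lt_one : g s₀ < 1
  strictConvexOn : StrictConvexOn ℝ (Icc 0 (s₀ ^ 2)) (dampingH g)
  one_mem_range : 1 ∈ range g

/-- The convex conjugate of the function equal to `H` on `[0, s₀²]` and to `+∞` elsewhere. -/
def conjH (g : ℝ → ℝ) (s₀ r : ℝ) : ℝ :=
  sSup ((fun s => r * s - dampingH g s) '' Icc 0 (s₀ ^ 2))

/-- `L(r) = Ĥ*(r) / r` for `r > 0`, and `L(0) = 0`. -/
def rateL (g : ℝ → ℝ) (s₀ r : ℝ) : ℝ := conjH g s₀ r / r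

/-- `Λ_H(s) = H(s) / (s H'(s))`. -/
def LambdaH (g : ℝ → ℝ) (s : ℝ) : ℝ := dampingH g s / (s * deriv (dampingH g) s)

/-- The inverse of `H' : [0, s₀²] → [0, H'(s₀²)]`, extended by the constant `s₀²` to the right of
`H'(s₀²)`. -/
def invDerivH (g : ℝ → ℝ) (s₀ v : ℝ) : ℝ :=
  sSup {s | s ∈ Icc 0 (s₀ ^ 2) ∧ deriv (dampingH g) s ≤ v}

/-- The function `ψ` on `[1 / H'(s₀²), ∞)`. -/
def psi (g : ℝ → ℝ) (s₀ s : ℝ) : ℝ :=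
  1 / deriv (dampingH g) (s₀ ^ 2) +
    ∫ v in (1 / s)..(deriv (dampingH g) (s₀ ^ 2)),
      1 / (v ^ 2 * (1 - LambdaH g (invDerivH g s₀ v)))

/-- The inverse of `ψ : [1 / H'(s₀²), ∞) → [1 / H'(s₀²), ∞)`, extended by the constant
`1 / H'(s₀²)` to the left of `1 / H'(s₀²)`. -/
def psiInv (g : ℝ → ℝ) (s₀ y : ℝ) : ℝ :=
  sInf {s | 1 / deriv (dampingH g) (s₀ ^ 2) ≤ s ∧ y ≤ psi g s₀ s}

/-- The sign condition `f r ≥ 0` almost everywhere. -/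
def HasSign {Ω : Type*} [MeasurableSpace Ω] (μ : Measure Ω) (f r : Ω → ℝ) : Prop :=
  ∀ᵐ x ∂μ, 0 ≤ f x * r x

/-- The growth conditions `c₁ g(|f|) ≤ |r| ≤ c₂ g⁻¹(|f|)` almost everywhere where `|f| ≤ 1`, and
`c₁ |f| ≤ |r| ≤ c₂ |f|` almost everywhere where `|f| ≥ 1`. -/
def HasGrowth {Ω : Type*} [MeasurableSpace Ω] (μ : Measure Ω) (g : ℝ → ℝ) (c₁ c₂ : ℝ)
    (f r : Ω → ℝ) : Prop :=
  ∀ᵐ x ∂μ,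
    (|f x| ≤ 1 → c₁ * g |f x| ≤ |r x| ∧ |r x| ≤ c₂ * Function.invFun g |f x|) ∧
    (1 ≤ |f x| → c₁ * |f x| ≤ |r x| ∧ |r x| ≤ c₂ * |f x|)

/-! ### The continuous setting -/

section Continuous

variable {X : Type*} [NormedAddCommGroup X] [InnerProductSpace ℝ X] [CompleteSpace X]
variable {Ω : Type*} [MeasurableSpace Ω] {μ : Measure Ω}

/-- `A` is a densely defined skew-adjoint operator. -/
def IsSkewAdjointOp (A : X →ₗ.[ℝ] X) : Prop :=
  Dense (A.domain : Set X) ∧ A.adjoint = -A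

/-- The mapping `F` seen through the isometry `U`: `ρ(f) = U⁻¹ F(U f)`. -/
def rhoMap (F : X → X) (U : Lp ℝ 2 μ ≃ₗᵢ[ℝ] X) (f : Lp ℝ 2 μ) : Lp ℝ 2 μ :=
  U.symm (F (U f))

/-- Standing assumptions on the operators `A`, `B`, the mapping `F` and the representation
`U⁻¹ B U f = b f` of `B` as a multiplication operator in `L²(Ω, μ)`. -/
structure ContinuousSetting (g : ℝ → ℝ) (c₁ c₂ : ℝ) (A : X →ₗ.[ℝ] X) (B : X →L[ℝ] X)
    (F : X → X) (b : Ω → ℝ) (U : Lp ℝ 2 μ ≃ₗᵢ[ℝ] X) : Prop where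
  skewAdjoint : IsSkewAdjointOp A
  nonneg_B : B.IsPositive
  lipschitz_F : ∀ R : ℝ, ∃ C : NNReal, LipschitzOnWith C F (Metric.closedBall 0 R)
  dissipative : ∀ u, 0 ≤ inner ℝ u (B (F u))
  measurable_b : Measurable b
  nonneg_b : ∀ x, 0 ≤ b x
  bounded_b : ∃ M, ∀ x, b x ≤ M
  mul_b : ∀ f : Lp ℝ 2 μ, (U.symm (B (U f)) : Ω → ℝ) =ᵐ[μ] fun x => b x * f x
  rho_zero : rhoMap F U 0 = 0
  sign : ∀ f : Lp ℝ 2 μ, HasSign μ f (rhoMap F U f)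
  growth : ∀ f : Lp ℝ 2 μ, MemLp f ⊤ μ → HasGrowth μ g c₁ c₂ f (rhoMap F U f)

/-- `R` is a bounded two-sided inverse of `m - A : D(A) → X`. -/
def IsResolvent (A : X →ₗ.[ℝ] X) (m : ℝ) (R : X →L[ℝ] X) : Prop :=
  (∀ x, ∃ hx : R x ∈ A.domain, m • R x - A ⟨R x, hx⟩ = x) ∧
    ∀ u : A.domain, R (m • (u : X) - A u) = u

open Classical in
/-- The resolvent `(m - A)⁻¹` (it exists for every `m > 0` if `A` is skew-adjoint). -/
def resolventOp (A : X →ₗ.[ℝ] X) (m : ℝ) : X →L[ℝ] X :=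
  if h : ∃ R, IsResolvent A m R then h.choose else 0

/-- The fractional power `(1 - A)^{-1/2} = (1/π) ∫_0^∞ l^{-1/2} (l + 1 - A)⁻¹ dl`. -/
def invSqrtOp (A : X →ₗ.[ℝ] X) : X →L[ℝ] X :=
  (1 / Real.pi) • ∫ l in Ioi (0 : ℝ), (l ^ (-(1 / 2) : ℝ)) • resolventOp A (l + 1)

/-- The space `X_{1/2}`: the range of `(1 - A)^{-1/2}`. The norm of `(1 - A)^{-1/2} x` in
`X_{1/2}` is `‖x‖`. -/
def HalfSpace (A : X →ₗ.[ℝ] X) : Submodule ℝ X := LinearMap.range (invSqrtOp A : X →ₗ[ℝ] X)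

/-- The surjection `(1 - A)^{-1/2} : X → X_{1/2}`. -/
def toHalf (A : X →ₗ.[ℝ] X) : X →ₗ[ℝ] HalfSpace A :=
  LinearMap.rangeRestrict (invSqrtOp A : X →ₗ[ℝ] X)

/-- The space `X_{-1/2}`: the linear forms on `X_{1/2}` that are bounded for the norm of
`X_{1/2}`. -/
def NegHalfSpace (A : X →ₗ.[ℝ] X) : Submodule ℝ (Module.Dual ℝ (HalfSpace A)) where
  carrier := {l | ∃ M : ℝ, ∀ x : X, |l (toHalf A x)| ≤ M * ‖x‖}
  zero_mem' := ⟨0, fun x => by simp⟩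
  add_mem' := by
    rintro l l' ⟨M, hM⟩ ⟨M', hM'⟩
    refine ⟨M + M', fun x => ?_⟩
    have h := abs_add_le (l (toHalf A x)) (l' (toHalf A x))
    have h1 := hM x
    have h2 := hM' x
    rw [LinearMap.add_apply]
    linarith
  smul_mem' := by
    rintro c l ⟨M, hM⟩
    refine ⟨|c| * M, fun x => ?_⟩
    rw [LinearMap.smul_apply, smul_eq_mul, abs_mul, mul_assoc]
    exact mul_le_mul_of_nonneg_left (hM x) (abs_nonneg c)

/-- The canonical injection `X → X_{-1/2}`, `u ↦ ⟨u, ·⟩`. -/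
def toNegHalf (A : X →ₗ.[ℝ] X) : X →ₗ[ℝ] NegHalfSpace A :=
  LinearMap.codRestrict (NegHalfSpace A)
    ((Submodule.subtype (HalfSpace A)).dualMap ∘ₗ innerₗ X) (by
      intro u
      refine ⟨‖u‖ * ‖invSqrtOp A‖, fun x => ?_⟩
      have h1 := abs_real_inner_le_norm u (invSqrtOp A x)
      have h2 := mul_le_mul_of_nonneg_left ((invSqrtOp A).le_opNorm x) (norm_nonneg u)
      rw [← mul_assoc] at h2
      exact h1.trans h2)

/-- `A'` is the canonical extension `X_{1/2} → X_{-1/2}` of `A`: the (unique, as `D(A)` is dense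
in `X_{1/2}`) bounded operator that coincides with `A` on `D(A)`. -/
def IsCanonicalExtension (A : X →ₗ.[ℝ] X) (A' : HalfSpace A →ₗ[ℝ] NegHalfSpace A) : Prop :=
  (∃ M : ℝ, ∀ x y : X, |(A' (toHalf A x)).1 (toHalf A y)| ≤ M * ‖x‖ * ‖y‖) ∧
    ∀ (u : HalfSpace A) (hu : (u : X) ∈ A.domain), A' u = toNegHalf A (A ⟨u, hu⟩)

/-! ### Space semi-discretizations -/

variable {V : Type*} [NormedAddCommGroup V] [InnerProductSpace ℝ V] [FiniteDimensional ℝ V]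

/-- The sampling operator `P : X_{-1/2} → V`, the adjoint of `P' : V → X_{1/2}`:
`⟨P l, v⟩ = l (P' v)`. -/
def samplingOp (A : X →ₗ.[ℝ] X) (P' : V →ₗ[ℝ] HalfSpace A) : NegHalfSpace A →ₗ[ℝ] V :=
  haveI : CompleteSpace V := FiniteDimensional.complete ℝ V
  { toFun := fun l => (InnerProductSpace.toDual ℝ V).symm
      (LinearMap.toContinuousLinearMap (l.1 ∘ₗ P'))
    map_add' := fun l l' => by
      rw [← map_add, ← map_add]
      rfl
    map_smul' := fun c l => by
      rw [RingHom.id_apply, ← map_smul]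
      rfl }

/-- The restriction of `P` to `X`. -/
def sample (A : X →ₗ.[ℝ] X) (P' : V →ₗ[ℝ] HalfSpace A) : X →ₗ[ℝ] V :=
  samplingOp A P' ∘ₗ toNegHalf A

/-- `A_Δx = P A P'`, through the extension `A' : X_{1/2} → X_{-1/2}` of `A`. -/
def discreteA (A : X →ₗ.[ℝ] X) (A' : HalfSpace A →ₗ[ℝ] NegHalfSpace A)
    (P' : V →ₗ[ℝ] HalfSpace A) : V →ₗ[ℝ] V :=
  samplingOp A P' ∘ₗ A' ∘ₗ P'

/-- `B_Δx = P B P'`. -/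
def discreteB (A : X →ₗ.[ℝ] X) (B : X →L[ℝ] X) (P' : V →ₗ[ℝ] HalfSpace A) : V →ₗ[ℝ] V :=
  sample A P' ∘ₗ (B : X →ₗ[ℝ] X) ∘ₗ (HalfSpace A).subtype ∘ₗ P'

/-- `F_Δx(u) = P F(P' u)`. -/
def discreteF (A : X →ₗ.[ℝ] X) (F : X → X) (P' : V →ₗ[ℝ] HalfSpace A) (u : V) : V :=
  sample A P' (F (P' u : X))

/-- The vector field `A_Δx u + B_Δx F_Δx(u) + (Δx)^σ 𝒱_Δx u`. -/
def schemeField (A : X →ₗ.[ℝ] X) (A' : HalfSpace A →ₗ[ℝ] NegHalfSpace A) (B : X →L[ℝ] X)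
    (F : X → X) (P' : V →ₗ[ℝ] HalfSpace A) (W : V →L[ℝ] V) (σ h : ℝ) (u : V) : V :=
  discreteA A A' P' u + discreteB A B P' (discreteF A F P' u) + h ^ σ • W u

/-- `u` solves `u' + G(u) = 0` on the time interval `J`. -/
def IsSolutionOn (G : V → V) (J : Set ℝ) (u : ℝ → V) : Prop :=
  ∀ t ∈ J, HasDerivWithinAt u (-G (u t)) J t

/-- The energy `E_u(t) = ‖u(t)‖² / 2`. -/
def energy (u : ℝ → V) (t : ℝ) : ℝ := 1 / 2 * ‖u t‖ ^ 2

/-- `U⁻¹ P' u`. -/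
def pulledBack {A : X →ₗ.[ℝ] X} (U : Lp ℝ 2 μ ≃ₗᵢ[ℝ] X) (P' : V →ₗ[ℝ] HalfSpace A) (u : V) :
    Lp ℝ 2 μ :=
  U.symm (P' u : X)

/-- The filtered mapping `U⁻¹ P' P U ρ(f)`. -/
def rhoTilde (A : X →ₗ.[ℝ] X) (F : X → X) (U : Lp ℝ 2 μ ≃ₗᵢ[ℝ] X) (P' : V →ₗ[ℝ] HalfSpace A)
    (f : Lp ℝ 2 μ) : Lp ℝ 2 μ :=
  pulledBack U P' (sample A P' (U (rhoMap F U f)))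

end Continuous

section Scheme

variable {X : Type*} [NormedAddCommGroup X] [InnerProductSpace ℝ X] [CompleteSpace X]
variable {Ω : Type*} [MeasurableSpace Ω] {μ : Measure Ω}
variable {V : ℝ → Type*} [∀ h, NormedAddCommGroup (V h)] [∀ h, InnerProductSpace ℝ (V h)]
  [∀ h, FiniteDimensional ℝ (V h)]

/-- Standing assumptions on the semi-discretization, for mesh sizes `h` in `(0, h₀)`. The norm of
`V h` is `‖v‖ = ‖P' v‖`, so that `P P' = id`. The square root of a nonnegative selfadjoint operator
`W` enters through `‖W^{1/2} v‖² = ⟨W v, v⟩` and `‖W^{1/2}‖² = ‖W‖`; `K` bounds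
`h^σ ‖𝒱_h^{1/2}‖²` for the mesh sizes `h ≤ h₁`. -/
structure DiscreteSetting (g : ℝ → ℝ) (c₁ c₂ : ℝ) (A : X →ₗ.[ℝ] X) (B : X →L[ℝ] X)
    (F : X → X) (U : Lp ℝ 2 μ ≃ₗᵢ[ℝ] X) (h₀ h₁ σ K : ℝ)
    (P' : ∀ h, V h →ₗ[ℝ] HalfSpace A) (W : ∀ h, V h →L[ℝ] V h) : Prop where
  pos_h₀ : 0 < h₀
  pos_h₁ : 0 < h₁
  pos_σ : 0 < σ
  norm_eq : ∀ h ∈ Ioo 0 h₀, ∀ v, ‖v‖ = ‖(P' h v : X)‖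
  convergent : ∀ u : X, Tendsto (fun h => ‖u - (P' h (sample A (P' h) u) : X)‖) (𝓝[>] 0) (𝓝 0)
  nonneg_W : ∀ h ∈ Ioo 0 h₀, (W h).IsPositive
  dissipative : ∀ h ∈ Ioo 0 h₀, ∀ u,
    0 ≤ inner ℝ u (discreteB A B (P' h) (discreteF A F (P' h) u)) + h ^ σ * inner ℝ (W h u) u
  bounded_W : ∀ h ∈ Ioo 0 h₀, h ≤ h₁ → h ^ σ * ‖W h‖ ≤ K
  sign : ∀ h ∈ Ioo 0 h₀, ∀ u,
    HasSign μ (pulledBack U (P' h) u) (rhoTilde A F U (P' h) (pulledBack U (P' h) u))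
  growth : ∀ h ∈ Ioo 0 h₀, ∀ u,
    HasGrowth μ g c₁ c₂ (pulledBack U (P' h) u)
      (rhoTilde A F U (P' h) (pulledBack U (P' h) u))

/-- The uniform observability inequality with viscosity, for the solutions of `φ' + A_h φ = 0`. -/
def UniformObservability (A : X →ₗ.[ℝ] X) (A' : HalfSpace A →ₗ[ℝ] NegHalfSpace A)
    (B : X →L[ℝ] X) (h₀ σ T CT : ℝ) (P' : ∀ h, V h →ₗ[ℝ] HalfSpace A)
    (W : ∀ h, V h →L[ℝ] V h) : Prop :=
  ∀ h ∈ Ioo 0 h₀, ∀ φ : ℝ → V h, IsSolutionOn (discreteA A A' (P' h)) univ φ →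
    CT * energy φ 0 ≤
      ∫ t in (0 : ℝ)..T,
        (inner ℝ (discreteB A B (P' h) (φ t)) (φ t) + h ^ σ * inner ℝ (W h (φ t)) (φ t))

end Scheme

end

/-!
The damped equation is compared with the conservative one. Let `φ' + A_h φ = 0` and let `u` solve
the damped equation with the same datum. The difference `u - φ` solves the conservative equation
with source `p = B_h F_h(u) + h^σ W u`; as `A_h` is skew-symmetric, `sup ‖u - φ‖²` on `[0, T]` is
at most `4 T ∫ ‖p‖²` (`norm_sq_le_of_perturbation`). Observability of `φ` therefore bounds
`E_u(0)` by a multiple of `∫ (⟨B_h u, u⟩ + ⟨B_h F_h u, F_h u⟩ + h^σ ⟨W u, u⟩)`.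

In `L²(Ω, μ)` the first two terms are `∫ b (f² + r²)`, while the dissipation of the energy
contains `∫ b f r`. For every weight `w > 0`, Young's inequality `w s ≤ H(s) + H*(w)` and the
growth conditions give the pointwise bound `w (f² + r²) ≤ C ((1 + w) f r + H*(w))`
(`exists_weighted_bound`). With `M` for `T² (‖B‖ + K)² + 1` this yields
`w C_T E(0) ≤ 16 C M ((1 + w) (E(0) - E(T)) + T ‖B‖ H*(w))`
(`weighted_energy_step`), and the same on each interval `[k T, (k + 1) T]`.

The rate `y(t) = L(1 / ψ⁻¹(t))` satisfies `y(t + d) ≥ y(t) (1 - 2 d / ψ⁻¹(t + d))`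
(`decayRate_add_ge`). Indeed, in the variable `s = 1 / v` the function `L` is a supremum of affine
functions, its derivative in `v` is `H((H')⁻¹(v)) / v²`, and the integrand of `ψ` dominates both
`1 / v²` and `(log L)'(v) / v`. If `E((k + 1) T)` exceeded `β y((k + 2) γ₂ T)`, the weighted
inequality with `w = 1 / ψ⁻¹((k + 2) γ₂ T)` would make the energy decrease faster than `y`, a
contradiction (`energy_le_decayRate`). The simplified rate follows from `ψ⁻¹(t) ≥ (1 - q) t` if
`Λ_H ≤ q < 1`.

Skew-symmetry of `A_h` reduces to `⟨A u, u⟩ = 0` on `D(A)` by density: `(1 - A)^{-1/2}` commutes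
with the resolvents, hence preserves `D(A)`. Global solutions come from the Picard-Lindelöf
theorem for a radially truncated field, whose solutions stay in the ball by dissipativity.
-/

/-! ### The profile `H` and its derivative -/

namespace IsDampingProfile

variable {g : ℝ → ℝ} {s₀ : ℝ}

lemma map_nonneg (hg : IsDampingProfile g s₀) {x : ℝ} (hx : 0 ≤ x) : 0 ≤ g x := by
  rw [← hg.map_zero]
  exact hg.strictMono.monotone hx

lemma map_pos (hg : IsDampingProfile g s₀) {x : ℝ} (hx : 0 < x) : 0 < g x := by
  rw [← hg.map_zero]
  exact hg.strictMono hx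

lemma differentiable (hg : IsDampingProfile g s₀) : Differentiable ℝ g :=
  hg.contDiff.differentiable one_ne_zero

lemma sq_pos (hg : IsDampingProfile g s₀) : 0 < s₀ ^ 2 := pow_pos hg.pos 2

lemma dampingH_zero : dampingH g 0 = 0 := by simp [dampingH]

lemma dampingH_nonneg (hg : IsDampingProfile g s₀) (s : ℝ) : 0 ≤ dampingH g s :=
  mul_nonneg (Real.sqrt_nonneg _) (hg.map_nonneg (Real.sqrt_nonneg _))

lemma dampingH_sq {x : ℝ} (hx : 0 ≤ x) : dampingH g (x ^ 2) = x * g x := by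
  rw [dampingH, Real.sqrt_sq hx]

lemma continuous_dampingH (hg : IsDampingProfile g s₀) : Continuous (dampingH g) :=
  Real.continuous_sqrt.mul (hg.contDiff.continuous.comp Real.continuous_sqrt)

lemma continuous_dslope (hg : IsDampingProfile g s₀) : Continuous (dslope g 0) := by
  refine continuous_iff_continuousAt.2 fun x => ?_
  rcases eq_or_ne x 0 with rfl | hx
  · exact continuousAt_dslope_same.2 (hg.differentiable 0)
  · exact (continuousAt_dslope_of_ne hx).2 hg.contDiff.continuous.continuousAt

lemma mul_dslope (hg : IsDampingProfile g s₀) (x : ℝ) : x * dslope g 0 x = g x := by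
  have h := sub_smul_dslope g 0 x
  simpa [hg.map_zero] using h

/-- The difference quotient `dslope g 0` makes the formula for `H'` valid, and continuous, up to
`s = 0`. -/
lemma hasDerivAt_dampingH (hg : IsDampingProfile g s₀) {s : ℝ} (hs : 0 ≤ s) :
    HasDerivAt (dampingH g) ((dslope g 0 (√s) + deriv g (√s)) / 2) s := by
  rcases hs.eq_or_lt with rfl | hs
  · have h0 : (dslope g 0 √0 + deriv g √0) / 2 = 0 := by simp [hg.deriv_zero]
    rw [h0, hasDerivAt_iff_isLittleO]
    have hlim : Tendsto (fun s => dslope g 0 √s) (𝓝 0) (𝓝 0) := by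
      have := (hg.continuous_dslope.comp Real.continuous_sqrt).tendsto 0
      simpa [Function.comp_def, hg.deriv_zero] using this
    have hO : (fun s : ℝ => max s 0) =O[𝓝 0] fun s => s := by
      refine Asymptotics.IsBigO.of_bound 1 (Eventually.of_forall fun s => ?_)
      rw [Real.norm_eq_abs, Real.norm_eq_abs, one_mul, abs_of_nonneg (le_max_right _ _)]
      exact max_le (le_abs_self _) (abs_nonneg _)
    have := hO.mul_isLittleO ((Asymptotics.isLittleO_one_iff ℝ).2 hlim)
    refine this.congr (fun s => ?_) fun s => by simp
    rw [dampingH_zero, smul_zero, sub_zero, sub_zero, dampingH, ← hg.mul_dslope √s, ← mul_assoc]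
    congr 1
    rcases le_total s 0 with h | h
    · rw [max_eq_right h, Real.sqrt_eq_zero'.2 h, mul_zero]
    · rw [max_eq_left h, Real.mul_self_sqrt h]
  · have hr : 0 < √s := Real.sqrt_pos.2 hs
    have h1 := Real.hasDerivAt_sqrt hs.ne'
    have h2 := (hg.differentiable √s).hasDerivAt.comp s h1
    refine (h1.mul h2).congr_deriv ?_
    rw [dslope_of_ne _ hr.ne', slope_def_field, hg.map_zero]
    simp only [Function.comp, sub_zero]
    field_simp

lemma deriv_dampingH (hg : IsDampingProfile g s₀) {s : ℝ} (hs : 0 ≤ s) :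
    deriv (dampingH g) s = (dslope g 0 (√s) + deriv g (√s)) / 2 :=
  (hg.hasDerivAt_dampingH hs).deriv

lemma differentiableAt_dampingH (hg : IsDampingProfile g s₀) {s : ℝ} (hs : 0 ≤ s) :
    DifferentiableAt ℝ (dampingH g) s :=
  (hg.hasDerivAt_dampingH hs).differentiableAt

lemma deriv_dampingH_zero (hg : IsDampingProfile g s₀) : deriv (dampingH g) 0 = 0 := by
  rw [hg.deriv_dampingH le_rfl]
  simp [hg.deriv_zero]

lemma continuousOn_deriv_dampingH (hg : IsDampingProfile g s₀) :
    ContinuousOn (deriv (dampingH g)) (Ici 0) := by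
  have : Continuous fun s => (dslope g 0 (√s) + deriv g (√s)) / 2 :=
    ((hg.continuous_dslope.comp Real.continuous_sqrt).add
      ((hg.contDiff.continuous_deriv le_rfl).comp Real.continuous_sqrt)).div_const 2
  exact this.continuousOn.congr fun s hs => hg.deriv_dampingH hs

lemma strictMonoOn_deriv_dampingH (hg : IsDampingProfile g s₀) :
    StrictMonoOn (deriv (dampingH g)) (Icc 0 (s₀ ^ 2)) :=
  hg.strictConvexOn.strictMonoOn_deriv fun _ hx => hg.differentiableAt_dampingH hx.1

lemma deriv_dampingH_pos (hg : IsDampingProfile g s₀) {s : ℝ} (hs : s ∈ Ioc 0 (s₀ ^ 2)) :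
    0 < deriv (dampingH g) s := by
  rw [← hg.deriv_dampingH_zero]
  exact hg.strictMonoOn_deriv_dampingH ⟨le_rfl, hg.sq_pos.le⟩ ⟨hs.1.le, hs.2⟩ hs.1

lemma dampingH_lt_mul_deriv (hg : IsDampingProfile g s₀) {s : ℝ} (hs : s ∈ Ioc 0 (s₀ ^ 2)) :
    dampingH g s < s * deriv (dampingH g) s := by
  have h := hg.strictConvexOn.slope_lt_of_hasDerivAt ⟨le_rfl, hg.sq_pos.le⟩ ⟨hs.1.le, hs.2⟩ hs.1
    (hg.differentiableAt_dampingH hs.1.le).hasDerivAt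
  rw [slope_def_field, dampingH_zero, sub_zero, sub_zero, div_lt_iff₀ hs.1] at h
  linarith

lemma tangent_le_dampingH (hg : IsDampingProfile g s₀) {s t : ℝ} (hs : s ∈ Icc 0 (s₀ ^ 2))
    (ht : t ∈ Icc 0 (s₀ ^ 2)) :
    dampingH g s + deriv (dampingH g) s * (t - s) ≤ dampingH g t := by
  have hd := (hg.differentiableAt_dampingH hs.1).hasDerivAt
  rcases lt_trichotomy s t with h | rfl | h
  · have := hg.strictConvexOn.convexOn.le_slope_of_hasDerivAt hs ht h hd
    rw [slope_def_field, le_div_iff₀ (by linarith)] at this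
    linarith
  · simp
  · have := hg.strictConvexOn.convexOn.slope_le_of_hasDerivAt ht hs h hd
    rw [slope_def_field, div_le_iff₀ (by linarith)] at this
    linarith

lemma LambdaH_lt_one (hg : IsDampingProfile g s₀) {s : ℝ} (hs : s ∈ Ioc 0 (s₀ ^ 2)) :
    LambdaH g s < 1 := by
  have h := mul_pos hs.1 (hg.deriv_dampingH_pos hs)
  rw [LambdaH, div_lt_one h]
  exact hg.dampingH_lt_mul_deriv hs

lemma LambdaH_nonneg (hg : IsDampingProfile g s₀) {s : ℝ} (hs : s ∈ Ioc 0 (s₀ ^ 2)) :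
    0 ≤ LambdaH g s :=
  div_nonneg (hg.dampingH_nonneg s) (mul_pos hs.1 (hg.deriv_dampingH_pos hs)).le

lemma continuousOn_LambdaH (hg : IsDampingProfile g s₀) :
    ContinuousOn (LambdaH g) (Ioc 0 (s₀ ^ 2)) := by
  refine hg.continuous_dampingH.continuousOn.div (continuousOn_id.mul
    (hg.continuousOn_deriv_dampingH.mono fun s hs => hs.1.le)) fun s hs => ?_
  exact (mul_pos hs.1 (hg.deriv_dampingH_pos hs)).ne'

/-! ### The inverse of `H'` -/

/-- The largest slope `H'(s₀²)`. -/
noncomputable def maxSlope (g : ℝ → ℝ) (s₀ : ℝ) : ℝ := deriv (dampingH g) (s₀ ^ 2)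

lemma maxSlope_pos (hg : IsDampingProfile g s₀) : 0 < maxSlope g s₀ :=
  hg.deriv_dampingH_pos ⟨hg.sq_pos, le_rfl⟩

lemma invDerivH_mono_of_nonneg (hg : IsDampingProfile g s₀) {v w : ℝ} (hv : 0 ≤ v) (hvw : v ≤ w) :
    invDerivH g s₀ v ≤ invDerivH g s₀ w := by
  refine csSup_le_csSup ⟨s₀ ^ 2, fun s hs => hs.1.2⟩
    ⟨0, ⟨le_rfl, hg.sq_pos.le⟩, hg.deriv_dampingH_zero.le.trans hv⟩ ?_
  exact fun s hs => ⟨hs.1, hs.2.trans hvw⟩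

lemma invDerivH_mem (hg : IsDampingProfile g s₀) (v : ℝ) :
    invDerivH g s₀ v ∈ Icc 0 (s₀ ^ 2) := by
  refine ⟨Real.sSup_nonneg fun s hs => hs.1.1, ?_⟩
  exact Real.sSup_le (fun s hs => hs.1.2) hg.sq_pos.le

lemma invDerivH_mono (hg : IsDampingProfile g s₀) : Monotone (invDerivH g s₀) := by
  intro v w hvw
  rcases le_or_gt 0 v with hv | hv
  · exact hg.invDerivH_mono_of_nonneg hv hvw
  · -- below `0` the set is empty and the supremum is `0`
    have : {s | s ∈ Icc 0 (s₀ ^ 2) ∧ deriv (dampingH g) s ≤ v} = ∅ := by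
      refine eq_empty_of_forall_notMem fun s hs => ?_
      have := hg.strictMonoOn_deriv_dampingH.monotoneOn ⟨le_rfl, hg.sq_pos.le⟩ hs.1 hs.1.1
      rw [hg.deriv_dampingH_zero] at this
      linarith [hs.2]
    rw [invDerivH, this, Real.sSup_empty]
    exact (hg.invDerivH_mem w).1

lemma invDerivH_deriv (hg : IsDampingProfile g s₀) {s : ℝ} (hs : s ∈ Icc 0 (s₀ ^ 2)) :
    invDerivH g s₀ (deriv (dampingH g) s) = s := by
  refine IsGreatest.csSup_eq ⟨⟨hs, le_rfl⟩, fun t ht => ?_⟩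
  exact (hg.strictMonoOn_deriv_dampingH.le_iff_le ht.1 hs).1 ht.2

lemma deriv_invDerivH (hg : IsDampingProfile g s₀) {v : ℝ} (hv : v ∈ Icc 0 (maxSlope g s₀)) :
    deriv (dampingH g) (invDerivH g s₀ v) = v := by
  have h := intermediate_value_Icc hg.sq_pos.le
    (hg.continuousOn_deriv_dampingH.mono fun s hs => hs.1)
  rw [hg.deriv_dampingH_zero] at h
  obtain ⟨s, hs, rfl⟩ := h hv
  rw [hg.invDerivH_deriv hs]

lemma invDerivH_pos (hg : IsDampingProfile g s₀) {v : ℝ} (hv : v ∈ Ioc 0 (maxSlope g s₀)) :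
    invDerivH g s₀ v ∈ Ioc 0 (s₀ ^ 2) := by
  refine ⟨(hg.invDerivH_mem v).1.lt_of_ne fun h => ?_, (hg.invDerivH_mem v).2⟩
  have := hg.deriv_invDerivH ⟨hv.1.le, hv.2⟩
  rw [← h, hg.deriv_dampingH_zero] at this
  exact hv.1.ne this

/-- A monotone map onto an interval is continuous. -/
lemma continuous_invDerivH (hg : IsDampingProfile g s₀) : Continuous (invDerivH g s₀) := by
  let f : ℝ → Icc 0 (s₀ ^ 2) := fun v => ⟨invDerivH g s₀ v, hg.invDerivH_mem v⟩
  have hf : Monotone f := fun v w h => hg.invDerivH_mono h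
  have hs : Function.Surjective f := fun s => ⟨_, Subtype.ext (hg.invDerivH_deriv s.2)⟩
  have : Fact ((0 : ℝ) ≤ s₀ ^ 2) := ⟨hg.sq_pos.le⟩
  exact continuous_subtype_val.comp (hf.continuous_of_surjective hs)

/-! ### The convex conjugate and the rate `L` -/

lemma bddAbove_conj (hg : IsDampingProfile g s₀) (r : ℝ) :
    BddAbove ((fun s => r * s - dampingH g s) '' Icc 0 (s₀ ^ 2)) :=
  (isCompact_Icc.image (by have := hg.continuous_dampingH; fun_prop)).bddAbove

/-- Young's inequality. -/
lemma mul_le_dampingH_add_conjH (hg : IsDampingProfile g s₀) (r : ℝ) {s : ℝ}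
    (hs : s ∈ Icc 0 (s₀ ^ 2)) : r * s ≤ dampingH g s + conjH g s₀ r := by
  have := le_csSup (hg.bddAbove_conj r) (mem_image_of_mem _ hs)
  simp only [conjH]
  linarith

lemma conjH_nonneg (hg : IsDampingProfile g s₀) (r : ℝ) : 0 ≤ conjH g s₀ r := by
  have := hg.mul_le_dampingH_add_conjH r (s := 0) ⟨le_rfl, hg.sq_pos.le⟩
  simpa [dampingH_zero] using this

lemma conjH_eq (hg : IsDampingProfile g s₀) {v : ℝ} (hv : v ∈ Ioc 0 (maxSlope g s₀)) :
    conjH g s₀ v = v * invDerivH g s₀ v - dampingH g (invDerivH g s₀ v) := by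
  refine IsGreatest.csSup_eq ⟨mem_image_of_mem _ (hg.invDerivH_mem v), ?_⟩
  rintro _ ⟨t, ht, rfl⟩
  have := hg.tangent_le_dampingH (hg.invDerivH_mem v) ht
  rw [hg.deriv_invDerivH ⟨hv.1.le, hv.2⟩] at this
  dsimp only
  linarith

lemma rateL_eq (hg : IsDampingProfile g s₀) {v : ℝ} (hv : v ∈ Ioc 0 (maxSlope g s₀)) :
    rateL g s₀ v = invDerivH g s₀ v - dampingH g (invDerivH g s₀ v) / v := by
  have := hv.1.ne'
  rw [rateL, hg.conjH_eq hv]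
  field_simp

lemma LambdaH_invDerivH (hg : IsDampingProfile g s₀) {v : ℝ} (hv : v ∈ Ioc 0 (maxSlope g s₀)) :
    LambdaH g (invDerivH g s₀ v) =
      dampingH g (invDerivH g s₀ v) / (invDerivH g s₀ v * v) := by
  rw [LambdaH, hg.deriv_invDerivH ⟨hv.1.le, hv.2⟩]

lemma rateL_eq_mul (hg : IsDampingProfile g s₀) {v : ℝ} (hv : v ∈ Ioc 0 (maxSlope g s₀)) :
    rateL g s₀ v = invDerivH g s₀ v * (1 - LambdaH g (invDerivH g s₀ v)) := by
  have h1 := hv.1.ne'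
  have h2 := (hg.invDerivH_pos hv).1.ne'
  rw [hg.rateL_eq hv, hg.LambdaH_invDerivH hv]
  field_simp

lemma rateL_pos (hg : IsDampingProfile g s₀) {v : ℝ} (hv : v ∈ Ioc 0 (maxSlope g s₀)) :
    0 < rateL g s₀ v := by
  have := hg.LambdaH_lt_one (hg.invDerivH_pos hv)
  rw [hg.rateL_eq_mul hv]
  exact mul_pos (hg.invDerivH_pos hv).1 (by linarith)

lemma rateL_le_invDerivH (hg : IsDampingProfile g s₀) {v : ℝ} (hv : v ∈ Ioc 0 (maxSlope g s₀)) :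
    rateL g s₀ v ≤ invDerivH g s₀ v := by
  rw [hg.rateL_eq hv]
  linarith [div_nonneg (hg.dampingH_nonneg (invDerivH g s₀ v)) hv.1.le]

/-- As a function of `1 / v`, `L` is a supremum of affine functions; this is its subgradient
inequality. -/
lemma rateL_subgradient (hg : IsDampingProfile g s₀) {v w : ℝ} (hv : v ∈ Ioc 0 (maxSlope g s₀))
    (hw : w ∈ Ioc 0 (maxSlope g s₀)) :
    dampingH g (invDerivH g s₀ v) * (1 / v - 1 / w) ≤ rateL g s₀ w - rateL g s₀ v := by
  have h := hg.mul_le_dampingH_add_conjH w (hg.invDerivH_mem v)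
  have h2 : invDerivH g s₀ v ≤ dampingH g (invDerivH g s₀ v) / w + rateL g s₀ w := by
    rw [rateL, ← add_div, le_div_iff₀ hw.1]
    linarith
  rw [hg.rateL_eq hv, mul_sub, mul_one_div, mul_one_div]
  linarith

lemma rateL_mono (hg : IsDampingProfile g s₀) {v w : ℝ} (hv : 0 < v) (hvw : v ≤ w)
    (hw : w ≤ maxSlope g s₀) : rateL g s₀ v ≤ rateL g s₀ w := by
  have h := hg.rateL_subgradient ⟨hv, hvw.trans hw⟩ ⟨hv.trans_le hvw, hw⟩
  have := mul_nonneg (hg.dampingH_nonneg (invDerivH g s₀ v))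
    (sub_nonneg.2 (one_div_le_one_div_of_le hv hvw))
  linarith

lemma continuousOn_rateL (hg : IsDampingProfile g s₀) :
    ContinuousOn (rateL g s₀) (Ioc 0 (maxSlope g s₀)) := by
  have h1 := hg.continuous_invDerivH
  have h2 := hg.continuous_dampingH
  have : ContinuousOn (fun v => invDerivH g s₀ v - dampingH g (invDerivH g s₀ v) / v)
      (Ioc 0 (maxSlope g s₀)) :=
    h1.continuousOn.sub ((h2.comp h1).continuousOn.div continuousOn_id fun v hv => hv.1.ne')
  exact this.congr fun v hv => hg.rateL_eq hv

lemma hasDerivAt_rateL (hg : IsDampingProfile g s₀) {v : ℝ} (hv : v ∈ Ioo 0 (maxSlope g s₀)) :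
    HasDerivAt (rateL g s₀) (dampingH g (invDerivH g s₀ v) / v ^ 2) v := by
  have hcont : Continuous fun u => dampingH g (invDerivH g s₀ u) :=
    hg.continuous_dampingH.comp hg.continuous_invDerivH
  -- the affine minorant touching `L` at `v` has the claimed derivative
  have hm : HasDerivAt (fun u => dampingH g (invDerivH g s₀ v) * (1 / v - 1 / u))
      (dampingH g (invDerivH g s₀ v) / v ^ 2) v := by
    have := ((hasDerivAt_inv hv.1.ne').const_sub (1 / v)).const_mul
      (dampingH g (invDerivH g s₀ v))
    simpa [div_eq_mul_inv] using this
  -- by the two subgradient inequalities the remainder is bounded by `o(1) * O(u - v)`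
  have hr : HasDerivAt
      (fun u => rateL g s₀ u - dampingH g (invDerivH g s₀ v) * (1 / v - 1 / u)) 0 v := by
    rw [hasDerivAt_iff_isLittleO]
    have h1 : (fun u => dampingH g (invDerivH g s₀ u) - dampingH g (invDerivH g s₀ v))
        =o[𝓝 v] fun _ => (1 : ℝ) := by
      rw [Asymptotics.isLittleO_one_iff]
      simpa using (hcont.tendsto v).sub_const (dampingH g (invDerivH g s₀ v))
    have h2 : (fun u : ℝ => 1 / v - 1 / u) =O[𝓝 v] fun u => u - v := by
      have := ((hasDerivAt_inv hv.1.ne').const_sub (1 / v)).isBigO_sub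
      refine this.congr_left fun u => ?_
      simp
    have h3 := (h1.mul_isBigO h2).congr_right fun u => one_mul (u - v)
    refine (Asymptotics.IsBigO.of_bound 1 ?_).trans_isLittleO h3
    filter_upwards [isOpen_Ioo.mem_nhds hv] with u hu
    have hv' : v ∈ Ioc 0 (maxSlope g s₀) := ⟨hv.1, hv.2.le⟩
    have hu' : u ∈ Ioc 0 (maxSlope g s₀) := ⟨hu.1, hu.2.le⟩
    have e1 := hg.rateL_subgradient hv' hu'
    have e2 := hg.rateL_subgradient hu' hv'
    rw [one_mul, Real.norm_eq_abs, Real.norm_eq_abs, abs_of_nonneg]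
    · refine le_trans ?_ (le_abs_self _)
      simp only [sub_self, mul_zero, sub_zero, smul_zero]
      linarith
    · simp only [sub_self, mul_zero, sub_zero, smul_zero]
      linarith
  refine ((hr.add hm).congr_deriv (zero_add _)).congr_of_eventuallyEq
    (Eventually.of_forall fun u => ?_)
  simp

end IsDampingProfile

/-! ### The functions `ψ` and `ψ⁻¹` -/

namespace IsDampingProfile

variable {g : ℝ → ℝ} {s₀ : ℝ}

/-- The integrand `1 / (v² (1 - Λ_H((H')⁻¹(v))))` of `ψ`. -/
noncomputable def psiKernel (g : ℝ → ℝ) (s₀ v : ℝ) : ℝ :=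
  1 / (v ^ 2 * (1 - LambdaH g (invDerivH g s₀ v)))

lemma continuousOn_psiKernel (hg : IsDampingProfile g s₀) :
    ContinuousOn (psiKernel g s₀) (Ioc 0 (maxSlope g s₀)) := by
  have h1 : ContinuousOn (fun v => LambdaH g (invDerivH g s₀ v)) (Ioc 0 (maxSlope g s₀)) :=
    hg.continuousOn_LambdaH.comp hg.continuous_invDerivH.continuousOn
      fun v hv => hg.invDerivH_pos hv
  refine continuousOn_const.div ((continuousOn_id.pow 2).mul (continuousOn_const.sub h1)) ?_
  intro v hv
  have := hg.LambdaH_lt_one (hg.invDerivH_pos hv)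
  exact (mul_pos (pow_pos hv.1 2) (by linarith)).ne'

lemma intervalIntegrable_psiKernel (hg : IsDampingProfile g s₀) {v w : ℝ} (hv : 0 < v)
    (hvw : v ≤ w) (hw : w ≤ maxSlope g s₀) :
    IntervalIntegrable (psiKernel g s₀) volume v w :=
  (hg.continuousOn_psiKernel.mono fun _ hu =>
    ⟨hv.trans_le hu.1, hu.2.trans hw⟩).intervalIntegrable_of_Icc hvw

lemma inv_sq_le_psiKernel (hg : IsDampingProfile g s₀) {v : ℝ}
    (hv : v ∈ Ioc 0 (maxSlope g s₀)) : 1 / v ^ 2 ≤ psiKernel g s₀ v := by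
  have h1 := hg.LambdaH_lt_one (hg.invDerivH_pos hv)
  have h0 := hg.LambdaH_nonneg (hg.invDerivH_pos hv)
  have h2 := pow_pos hv.1 2
  exact one_div_le_one_div_of_le (mul_pos h2 (by linarith))
    (mul_le_of_le_one_right h2.le (by linarith))

/-- The kernel of `ψ` dominates `(log L)'(v) / v = Λ / (v² (1 - Λ))`. -/
lemma logDeriv_rateL_le (hg : IsDampingProfile g s₀) {v : ℝ} (hv : v ∈ Ioc 0 (maxSlope g s₀)) :
    dampingH g (invDerivH g s₀ v) / v ^ 2 / rateL g s₀ v ≤ v * psiKernel g s₀ v := by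
  have hs := hg.invDerivH_pos hv
  have h1 := hg.LambdaH_lt_one hs
  have h3 : dampingH g (invDerivH g s₀ v) =
      LambdaH g (invDerivH g s₀ v) * (invDerivH g s₀ v * v) := by
    rw [hg.LambdaH_invDerivH hv, div_mul_cancel₀ _ (mul_pos hs.1 hv.1).ne']
  have h4 : dampingH g (invDerivH g s₀ v) / v ^ 2 / rateL g s₀ v =
      LambdaH g (invDerivH g s₀ v) * (v * psiKernel g s₀ v) := by
    have a1 := hs.1.ne'
    have a2 := hv.1.ne'
    have a3 : 1 - LambdaH g (invDerivH g s₀ v) ≠ 0 := by linarith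
    rw [hg.rateL_eq_mul hv, h3, psiKernel]
    field_simp
  rw [h4]
  refine mul_le_of_le_one_left ?_ h1.le
  have h5 : 0 ≤ 1 / v ^ 2 := by positivity
  exact mul_nonneg hv.1.le (h5.trans (hg.inv_sq_le_psiKernel hv))

lemma integral_inv_sq {v w : ℝ} (hv : 0 < v) (hvw : v ≤ w) :
    ∫ u in v..w, 1 / u ^ 2 = 1 / v - 1 / w := by
  have h : ∀ u ∈ uIcc v w, u ≠ 0 := fun u hu => by
    rw [uIcc_of_le hvw] at hu
    exact (hv.trans_le hu.1).ne'
  rw [intervalIntegral.integral_eq_sub_of_hasDerivAt (f := fun u => -(1 / u))]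
  · ring
  · intro u hu
    have : HasDerivAt (fun u : ℝ => -u⁻¹) _ u := (hasDerivAt_inv (h u hu)).neg
    simpa using this
  · refine ContinuousOn.intervalIntegrable ?_
    exact continuousOn_const.div (continuousOn_id.pow 2) fun u hu => pow_ne_zero 2 (h u hu)

lemma integral_inv_sq_le_integral_psiKernel (hg : IsDampingProfile g s₀) {v w : ℝ} (hv : 0 < v)
    (hvw : v ≤ w) (hw : w ≤ maxSlope g s₀) :
    1 / v - 1 / w ≤ ∫ u in v..w, psiKernel g s₀ u := by
  rw [← integral_inv_sq hv hvw]
  refine intervalIntegral.integral_mono_on hvw ?_ (hg.intervalIntegrable_psiKernel hv hvw hw) ?_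
  · refine ContinuousOn.intervalIntegrable_of_Icc hvw ?_
    exact continuousOn_const.div (continuousOn_id.pow 2) fun u hu =>
      pow_ne_zero 2 (hv.trans_le hu.1).ne'
  · exact fun u hu => hg.inv_sq_le_psiKernel ⟨hv.trans_le hu.1, hu.2.trans hw⟩

lemma log_rateL_sub_le (hg : IsDampingProfile g s₀) {v w : ℝ} (hv : 0 < v)
    (hvw : v ≤ w) (hw : w ≤ maxSlope g s₀) :
    Real.log (rateL g s₀ w) - Real.log (rateL g s₀ v) ≤
      w * ∫ u in v..w, psiKernel g s₀ u := by
  have hmem : ∀ u ∈ Icc v w, u ∈ Ioc 0 (maxSlope g s₀) :=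
    fun u hu => ⟨hv.trans_le hu.1, hu.2.trans hw⟩
  have hne : ∀ u ∈ Icc v w, rateL g s₀ u ≠ 0 := fun u hu => (hg.rateL_pos (hmem u hu)).ne'
  have hcL := hg.continuousOn_rateL.mono hmem
  have hcd : ContinuousOn (fun u => dampingH g (invDerivH g s₀ u) / u ^ 2 / rateL g s₀ u)
      (Icc v w) := by
    refine ContinuousOn.div (ContinuousOn.div
      (hg.continuous_dampingH.comp hg.continuous_invDerivH).continuousOn (continuousOn_id.pow 2)
      fun u hu => pow_ne_zero 2 (hmem u hu).1.ne') hcL hne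
  rw [← intervalIntegral.integral_eq_sub_of_hasDerivAt_of_le hvw
      (f := fun u => Real.log (rateL g s₀ u)) (hcL.log hne)
      (fun u hu => (hg.hasDerivAt_rateL ⟨hv.trans hu.1, hu.2.trans_le hw⟩).log
        (hne u ⟨hu.1.le, hu.2.le⟩))
      (hcd.intervalIntegrable_of_Icc hvw),
    ← intervalIntegral.integral_const_mul]
  have hk := hg.intervalIntegrable_psiKernel hv hvw hw
  refine intervalIntegral.integral_mono_on hvw (hcd.intervalIntegrable_of_Icc hvw)
    (hk.const_mul w) fun u hu => (hg.logDeriv_rateL_le (hmem u hu)).trans ?_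
  have h0 : 0 ≤ 1 / u ^ 2 := by positivity
  exact mul_le_mul_of_nonneg_right hu.2 (h0.trans (hg.inv_sq_le_psiKernel (hmem u hu)))

lemma one_div_mem (hg : IsDampingProfile g s₀) {s : ℝ} (hs : 1 / maxSlope g s₀ ≤ s) :
    0 < s ∧ 1 / s ∈ Ioc 0 (maxSlope g s₀) := by
  have h0 : 0 < s := (one_div_pos.2 hg.maxSlope_pos).trans_le hs
  exact ⟨h0, one_div_pos.2 h0, (one_div_le h0 hg.maxSlope_pos).2 hs⟩

lemma psi_sub (hg : IsDampingProfile g s₀) {s t : ℝ} (hs : 1 / maxSlope g s₀ ≤ s) (hst : s ≤ t) :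
    psi g s₀ t - psi g s₀ s = ∫ u in (1 / t)..(1 / s), psiKernel g s₀ u := by
  have h1 := hg.one_div_mem hs
  have h2 := hg.one_div_mem (hs.trans hst)
  have h3 := one_div_le_one_div_of_le h1.1 hst
  have := intervalIntegral.integral_add_adjacent_intervals
    (hg.intervalIntegrable_psiKernel h2.2.1 h3 h1.2.2)
    (hg.intervalIntegrable_psiKernel h1.2.1 h1.2.2 le_rfl)
  change (_ + ∫ u in (1 / t)..(maxSlope g s₀), psiKernel g s₀ u) -
    (_ + ∫ u in (1 / s)..(maxSlope g s₀), psiKernel g s₀ u) = _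
  rw [← this]
  ring

lemma psi_left : psi g s₀ (1 / maxSlope g s₀) = 1 / maxSlope g s₀ := by
  simp [psi, maxSlope]

lemma sub_le_psi_sub (hg : IsDampingProfile g s₀) {s t : ℝ} (hs : 1 / maxSlope g s₀ ≤ s)
    (hst : s ≤ t) : t - s ≤ psi g s₀ t - psi g s₀ s := by
  have h1 := hg.one_div_mem hs
  have h2 := hg.one_div_mem (hs.trans hst)
  have := hg.integral_inv_sq_le_integral_psiKernel h2.2.1
    (one_div_le_one_div_of_le h1.1 hst) h1.2.2
  rw [hg.psi_sub hs hst]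
  simpa using this

lemma le_psi (hg : IsDampingProfile g s₀) {s : ℝ} (hs : 1 / maxSlope g s₀ ≤ s) :
    s ≤ psi g s₀ s := by
  have := hg.sub_le_psi_sub le_rfl hs
  rw [psi_left] at this
  linarith

/-- The integral inequality for `log L`, exponentiated:
`L(1/t) ≥ L(1/s) (1 - (ψ(t) - ψ(s)) / s)`. -/
lemma rateL_psi_le (hg : IsDampingProfile g s₀) {s t : ℝ} (hs : 1 / maxSlope g s₀ ≤ s)
    (hst : s ≤ t) :
    rateL g s₀ (1 / s) * (1 - 1 / s * (psi g s₀ t - psi g s₀ s)) ≤ rateL g s₀ (1 / t) := by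
  have h1 := hg.one_div_mem hs
  have h2 := hg.one_div_mem (hs.trans hst)
  have h := hg.log_rateL_sub_le h2.2.1 (one_div_le_one_div_of_le h1.1 hst) h1.2.2
  rw [← hg.psi_sub hs hst] at h
  have p1 := hg.rateL_pos h1.2
  have p2 := hg.rateL_pos h2.2
  set d := 1 / s * (psi g s₀ t - psi g s₀ s)
  have h3 : rateL g s₀ (1 / s) * Real.exp (-d) ≤ rateL g s₀ (1 / t) := by
    rw [← Real.log_le_log_iff (by positivity) p2, Real.log_mul p1.ne' (Real.exp_pos _).ne',
      Real.log_exp]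
    linarith
  refine le_trans (mul_le_mul_of_nonneg_left ?_ p1.le) h3
  linarith [Real.add_one_le_exp (-d)]

lemma strictMonoOn_psi (hg : IsDampingProfile g s₀) :
    StrictMonoOn (psi g s₀) (Ici (1 / maxSlope g s₀)) := by
  intro s hs t _ hst
  linarith [hg.sub_le_psi_sub hs hst.le]

lemma continuousOn_psi (hg : IsDampingProfile g s₀) {b : ℝ} (hb : 1 / maxSlope g s₀ ≤ b) :
    ContinuousOn (psi g s₀) (Icc (1 / maxSlope g s₀) b) := by
  have hmem := hg.one_div_mem hb
  have hi := hg.intervalIntegrable_psiKernel hmem.2.1 hmem.2.2 le_rfl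
  have hc := intervalIntegral.continuousOn_primitive_interval_left
    ((intervalIntegrable_iff_integrableOn_Icc_of_le hmem.2.2).1 hi |>.mono_set
      (by rw [uIcc_of_le hmem.2.2]))
  rw [uIcc_of_le hmem.2.2] at hc
  have hinv : ContinuousOn (fun s : ℝ => 1 / s) (Icc (1 / maxSlope g s₀) b) :=
    continuousOn_const.div continuousOn_id fun s hs => (hg.one_div_mem hs.1).1.ne'
  exact continuousOn_const.add (hc.comp hinv fun s hs =>
    ⟨one_div_le_one_div_of_le (hg.one_div_mem hs.1).1 hs.2, (hg.one_div_mem hs.1).2.2⟩)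

lemma exists_psi_eq_psiInv_eq (hg : IsDampingProfile g s₀) (y : ℝ) :
    ∃ s, 1 / maxSlope g s₀ ≤ s ∧ psi g s₀ s = max y (1 / maxSlope g s₀) ∧ psiInv g s₀ y = s := by
  set y' := max y (1 / maxSlope g s₀)
  have hy' : 1 / maxSlope g s₀ ≤ y' := le_max_right _ _
  have h := intermediate_value_Icc hy' (hg.continuousOn_psi hy')
  rw [psi_left] at h
  obtain ⟨s, hs, hsy⟩ := h ⟨hy', hg.le_psi hy'⟩
  refine ⟨s, hs.1, hsy, IsLeast.csInf_eq ⟨⟨hs.1, (le_max_left _ _).trans hsy.ge⟩, ?_⟩⟩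
  rintro t ⟨ht1, ht2⟩
  refine (hg.strictMonoOn_psi.le_iff_le hs.1 ht1).1 ?_
  rw [hsy]
  exact max_le ht2 (ht1.trans (hg.le_psi ht1))

lemma le_psiInv (hg : IsDampingProfile g s₀) (y : ℝ) : 1 / maxSlope g s₀ ≤ psiInv g s₀ y := by
  obtain ⟨s, hs, -, h⟩ := hg.exists_psi_eq_psiInv_eq y
  rwa [h]

lemma psi_psiInv (hg : IsDampingProfile g s₀) (y : ℝ) :
    psi g s₀ (psiInv g s₀ y) = max y (1 / maxSlope g s₀) := by
  obtain ⟨s, -, h', h⟩ := hg.exists_psi_eq_psiInv_eq y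
  rwa [h]

lemma psiInv_eq_left (hg : IsDampingProfile g s₀) {y : ℝ} (hy : y ≤ 1 / maxSlope g s₀) :
    psiInv g s₀ y = 1 / maxSlope g s₀ := by
  refine hg.strictMonoOn_psi.injOn (hg.le_psiInv y) self_mem_Ici ?_
  rw [hg.psi_psiInv, psi_left, max_eq_right hy]

lemma psiInv_mono (hg : IsDampingProfile g s₀) : Monotone (psiInv g s₀) := by
  intro y z hyz
  refine (hg.strictMonoOn_psi.le_iff_le (hg.le_psiInv y) (hg.le_psiInv z)).1 ?_
  rw [hg.psi_psiInv, hg.psi_psiInv]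
  exact max_le_max hyz le_rfl

lemma psi_psiInv_sub_le (hg : IsDampingProfile g s₀) (y : ℝ) {d : ℝ} (hd : 0 ≤ d) :
    psi g s₀ (psiInv g s₀ (y + d)) - psi g s₀ (psiInv g s₀ y) ≤ d := by
  rw [hg.psi_psiInv, hg.psi_psiInv, sub_le_iff_le_add]
  refine max_le ?_ ?_
  · linarith [le_max_left y (1 / maxSlope g s₀)]
  · linarith [le_max_right y (1 / maxSlope g s₀)]

/-- `ψ⁻¹` is `1`-Lipschitz. -/
lemma psiInv_add_le (hg : IsDampingProfile g s₀) (y : ℝ) {d : ℝ} (hd : 0 ≤ d) :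
    psiInv g s₀ (y + d) ≤ psiInv g s₀ y + d := by
  have h1 := hg.sub_le_psi_sub (hg.le_psiInv y) (hg.psiInv_mono (by linarith : y ≤ y + d))
  linarith [hg.psi_psiInv_sub_le y hd]

/-- The rate `t ↦ L(1 / ψ⁻¹(t))`. -/
noncomputable def decayRate (g : ℝ → ℝ) (s₀ t : ℝ) : ℝ := rateL g s₀ (1 / psiInv g s₀ t)

lemma decayRate_pos (hg : IsDampingProfile g s₀) (t : ℝ) : 0 < decayRate g s₀ t :=
  hg.rateL_pos (hg.one_div_mem (hg.le_psiInv t)).2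

lemma decayRate_antitone (hg : IsDampingProfile g s₀) : Antitone (decayRate g s₀) := by
  intro y z hyz
  have hy := hg.one_div_mem (hg.le_psiInv y)
  exact hg.rateL_mono (hg.one_div_mem (hg.le_psiInv z)).2.1
    (one_div_le_one_div_of_le hy.1 (hg.psiInv_mono hyz)) hy.2.2

/-- The rate decays at most like a solution of `y' = -y / ψ⁻¹(t)`. The factor `2` allows the
evaluation of `1 / ψ⁻¹` at the right end of the step. -/
lemma decayRate_add_ge (hg : IsDampingProfile g s₀) (y : ℝ) {d : ℝ} (hd : 0 ≤ d)
    (hd' : d ≤ 1 / maxSlope g s₀) :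
    decayRate g s₀ y * (1 - 2 * d * (1 / psiInv g s₀ (y + d))) ≤ decayRate g s₀ (y + d) := by
  have hle := hg.psiInv_mono (by linarith : y ≤ y + d)
  have h := hg.rateL_psi_le (hg.le_psiInv y) hle
  refine le_trans (mul_le_mul_of_nonneg_left ?_ (hg.decayRate_pos y).le) h
  have hp := (hg.one_div_mem (hg.le_psiInv y)).1
  have hq := (hg.one_div_mem (hg.le_psiInv (y + d))).1
  have h2 : 1 / psiInv g s₀ y ≤ 2 * (1 / psiInv g s₀ (y + d)) := by
    rw [mul_one_div, div_le_div_iff₀ hp hq]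
    linarith [hg.psiInv_add_le y hd, hg.le_psiInv y]
  have h3 := mul_le_mul h2 (hg.psi_psiInv_sub_le y hd)
    (sub_nonneg.2 (hg.strictMonoOn_psi.monotoneOn (hg.le_psiInv y) (hg.le_psiInv (y + d)) hle))
    (by positivity)
  linarith

/-! ### The simplified rate -/

lemma exists_LambdaH_le (hg : IsDampingProfile g s₀) (h : limsup (LambdaH g) (𝓝[>] 0) < 1) :
    ∃ q < 1, ∀ s ∈ Ioc 0 (s₀ ^ 2), LambdaH g s ≤ q := by
  obtain ⟨q, hq, hq1⟩ := exists_between h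
  have hmem : Ioo 0 (s₀ ^ 2) ∈ 𝓝[>] (0 : ℝ) := Ioo_mem_nhdsGT hg.sq_pos
  have hbdd : IsBoundedUnder (· ≤ ·) (𝓝[>] 0) (LambdaH g) :=
    ⟨1, eventually_map.2 (by
      filter_upwards [hmem] with s hs using (hg.LambdaH_lt_one ⟨hs.1, hs.2.le⟩).le)⟩
  obtain ⟨e, he, he'⟩ := (mem_nhdsGT_iff_exists_Ioc_subset).1 (eventually_lt_of_limsup_lt hq hbdd)
  have hsub : Icc (min e (s₀ ^ 2)) (s₀ ^ 2) ⊆ Ioc 0 (s₀ ^ 2) := fun s hs =>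
    ⟨(lt_min he hg.sq_pos).trans_le hs.1, hs.2⟩
  obtain ⟨m, hm, hmax⟩ := isCompact_Icc.exists_isMaxOn
    (nonempty_Icc.2 (min_le_right e (s₀ ^ 2))) (hg.continuousOn_LambdaH.mono hsub)
  refine ⟨max q (LambdaH g m), max_lt hq1 (hg.LambdaH_lt_one (hsub hm)), fun s hs => ?_⟩
  rcases le_or_gt s e with hse | hse
  · exact (he' ⟨hs.1, hse⟩).le.trans (le_max_left _ _)
  · exact (hmax ⟨(min_le_left _ _).trans hse.le, hs.2⟩).trans (le_max_right _ _)

lemma mul_le_psiInv (hg : IsDampingProfile g s₀) {q : ℝ} (hq : q < 1)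
    (hΛ : ∀ s ∈ Ioc 0 (s₀ ^ 2), LambdaH g s ≤ q) (y : ℝ) :
    (1 - q) * y ≤ psiInv g s₀ y := by
  have hq0 : 0 ≤ q :=
    (hg.LambdaH_nonneg ⟨hg.sq_pos, le_rfl⟩).trans (hΛ _ ⟨hg.sq_pos, le_rfl⟩)
  set s := psiInv g s₀ y
  have hs : 1 / maxSlope g s₀ ≤ s := hg.le_psiInv y
  have hm := hg.one_div_mem hs
  have hm0 : 0 < 1 / maxSlope g s₀ := one_div_pos.2 hg.maxSlope_pos
  have h1 : ∫ u in (1 / s)..(maxSlope g s₀), psiKernel g s₀ u ≤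
      ∫ u in (1 / s)..(maxSlope g s₀), 1 / (1 - q) * (1 / u ^ 2) := by
    refine intervalIntegral.integral_mono_on hm.2.2
      (hg.intervalIntegrable_psiKernel hm.2.1 hm.2.2 le_rfl) ?_ fun u hu => ?_
    · refine ContinuousOn.intervalIntegrable_of_Icc hm.2.2 (continuousOn_const.mul ?_)
      exact continuousOn_const.div (continuousOn_id.pow 2) fun u hu =>
        pow_ne_zero 2 (hm.2.1.trans_le hu.1).ne'
    · have hu0 : 0 < u := hm.2.1.trans_le hu.1
      have := hΛ _ (hg.invDerivH_pos ⟨hu0, hu.2⟩)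
      rw [psiKernel, one_div_mul_one_div, mul_comm (1 - q)]
      exact one_div_le_one_div_of_le (mul_pos (pow_pos hu0 2) (by linarith))
        (mul_le_mul_of_nonneg_left (by linarith) (pow_pos hu0 2).le)
  rw [intervalIntegral.integral_const_mul, integral_inv_sq hm.2.1 hm.2.2, one_div_one_div] at h1
  have h2 : psi g s₀ s = 1 / maxSlope g s₀ + ∫ u in (1 / s)..(maxSlope g s₀), psiKernel g s₀ u :=
    rfl
  have h3 : y ≤ psi g s₀ s := by
    rw [hg.psi_psiInv]
    exact le_max_left _ _
  have h4 : (1 - q) * (1 / (1 - q) * (s - 1 / maxSlope g s₀)) = s - 1 / maxSlope g s₀ := by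
    have : 1 - q ≠ 0 := by linarith
    field_simp
  have h5 := mul_le_mul_of_nonneg_left (h3.trans (h2.le.trans (add_le_add_right h1 _)))
    (by linarith : 0 ≤ 1 - q)
  rw [mul_add, h4] at h5
  nlinarith

lemma decayRate_le_invDerivH (hg : IsDampingProfile g s₀) {q : ℝ} (hq : q < 1)
    (hΛ : ∀ s ∈ Ioc 0 (s₀ ^ 2), LambdaH g s ≤ q) {y : ℝ} (hy : 0 < y) :
    decayRate g s₀ y ≤ invDerivH g s₀ (1 / ((1 - q) * y)) := by
  have hm := hg.one_div_mem (hg.le_psiInv y)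
  refine (hg.rateL_le_invDerivH hm.2).trans (hg.invDerivH_mono ?_)
  exact one_div_le_one_div_of_le (mul_pos (by linarith) hy) (hg.mul_le_psiInv hq hΛ y)

end IsDampingProfile

/-! ### Dissipative differential equations in finite dimension -/

section DissipativeODE

variable {V : Type*} [NormedAddCommGroup V] [InnerProductSpace ℝ V]

/-- The radial retraction onto the closed ball of radius `R`. It moves points along rays, so that
composing with it preserves the dissipativity of a vector field. -/
noncomputable def radialTrunc (R : ℝ) (x : V) : V := (R / max R ‖x‖) • x

lemma radialTrunc_of_norm_le {R : ℝ} (hR : 0 < R) {x : V} (hx : ‖x‖ ≤ R) :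
    radialTrunc R x = x := by
  rw [radialTrunc, max_eq_left hx, div_self hR.ne', one_smul]

lemma norm_radialTrunc_le {R : ℝ} (hR : 0 < R) (x : V) : ‖radialTrunc R x‖ ≤ R := by
  have hm : 0 < max R ‖x‖ := hR.trans_le (le_max_left _ _)
  rw [radialTrunc, norm_smul, Real.norm_of_nonneg (div_pos hR hm).le, div_mul_eq_mul_div,
    div_le_iff₀ hm]
  exact mul_le_mul_of_nonneg_left (le_max_right _ _) hR.le

lemma lipschitzWith_radialTrunc {R : ℝ} (hR : 0 < R) :
    LipschitzWith 2 (radialTrunc R : V → V) := by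
  refine LipschitzWith.of_dist_le_mul fun x y => ?_
  have hx : 0 < max R ‖x‖ := hR.trans_le (le_max_left _ _)
  have hy : 0 < max R ‖y‖ := hR.trans_le (le_max_left _ _)
  have hsplit : radialTrunc R x - radialTrunc R y =
      (R / max R ‖x‖) • (x - y) + (R / max R ‖x‖ - R / max R ‖y‖) • y := by
    simp only [radialTrunc]
    module
  have h1 : ‖(R / max R ‖x‖) • (x - y)‖ ≤ ‖x - y‖ := by
    rw [norm_smul, Real.norm_of_nonneg (div_pos hR hx).le]
    exact mul_le_of_le_one_left (norm_nonneg _) ((div_le_one hx).2 (le_max_left _ _))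
  have h2 : ‖(R / max R ‖x‖ - R / max R ‖y‖) • y‖ ≤ ‖x - y‖ := by
    have e : R / max R ‖x‖ - R / max R ‖y‖ =
        R / max R ‖x‖ * ((max R ‖y‖ - max R ‖x‖) / max R ‖y‖) := by
      field_simp
    rw [norm_smul, e, norm_mul, norm_div _ (max R ‖y‖), Real.norm_of_nonneg (div_pos hR hx).le,
      Real.norm_of_nonneg hy.le, mul_assoc, div_mul_eq_mul_div ‖max R ‖y‖ - max R ‖x‖‖]
    have a1 : ‖max R ‖y‖ - max R ‖x‖‖ ≤ ‖x - y‖ := by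
      have := abs_max_sub_max_le_abs ‖y‖ ‖x‖ R
      rw [max_comm ‖y‖, max_comm ‖x‖] at this
      refine this.trans ?_
      rw [norm_sub_rev x y]
      exact abs_norm_sub_norm_le y x
    have a2 : ‖max R ‖y‖ - max R ‖x‖‖ * ‖y‖ / max R ‖y‖ ≤ ‖x - y‖ := by
      rw [div_le_iff₀ hy]
      exact mul_le_mul a1 (le_max_right _ _) (norm_nonneg _) (norm_nonneg _)
    exact (mul_le_of_le_one_left (by positivity)
      ((div_le_one hx).2 (le_max_left _ _))).trans a2
  rw [dist_eq_norm, dist_eq_norm, hsplit]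
  refine (norm_add_le _ _).trans ?_
  push_cast
  linarith

lemma IsSolutionOn.continuousOn {G : V → V} {J : Set ℝ} {u : ℝ → V} (hu : IsSolutionOn G J u) :
    ContinuousOn u J := fun t ht => (hu t ht).continuousWithinAt

lemma IsSolutionOn.mono {G : V → V} {J J' : Set ℝ} {u : ℝ → V} (hu : IsSolutionOn G J u)
    (h : J' ⊆ J) : IsSolutionOn G J' u := fun t ht => (hu t (h ht)).mono h

lemma IsSolutionOn.shift {G : V → V} {u : ℝ → V} (hu : IsSolutionOn G (Ici 0) u) {a : ℝ}
    (ha : 0 ≤ a) : IsSolutionOn G (Ici 0) fun t => u (a + t) := by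
  intro t ht
  have h := hu (a + t) (add_nonneg ha ht)
  have h2 : HasDerivWithinAt (fun t => a + t) 1 (Ici 0) t :=
    ((hasDerivAt_id t).const_add a).hasDerivWithinAt
  have := h.scomp t h2 fun s hs => add_nonneg ha hs
  simpa [Function.comp_def] using this

lemma IsSolutionOn.hasDerivWithinAt_energy {G : V → V} {J : Set ℝ} {u : ℝ → V}
    (hu : IsSolutionOn G J u) {t : ℝ} (ht : t ∈ J) :
    HasDerivWithinAt (energy u) (-inner ℝ (u t) (G (u t))) J t := by
  refine ((hu t ht).norm_sq.const_mul (1 / 2)).congr_deriv ?_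
  rw [inner_neg_right]
  ring

lemma energy_nonneg {V : Type*} [NormedAddCommGroup V] (u : ℝ → V) (t : ℝ) : 0 ≤ energy u t := by
  unfold energy
  positivity

lemma norm_le_of_energy_le {V : Type*} [NormedAddCommGroup V] {u v : ℝ → V} {s t : ℝ}
    (h : energy u t ≤ energy v s) :
    ‖u t‖ ≤ ‖v s‖ := by
  unfold energy at h
  exact (sq_le_sq₀ (norm_nonneg _) (norm_nonneg _)).1 (by linarith)

lemma IsSolutionOn.antitoneOn_energy {G : V → V} {J : Set ℝ} {u : ℝ → V}
    (hu : IsSolutionOn G J u) (hJ : Convex ℝ J) (hG : ∀ x, 0 ≤ inner ℝ x (G x)) :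
    AntitoneOn (energy u) J := by
  have hd : ∀ t ∈ interior J, HasDerivAt (energy u) (-inner ℝ (u t) (G (u t))) t := fun t ht =>
    (hu.hasDerivWithinAt_energy (interior_subset ht)).hasDerivAt (mem_interior_iff_mem_nhds.1 ht)
  refine antitoneOn_of_deriv_nonpos hJ
    (fun t ht => (hu.hasDerivWithinAt_energy ht).continuousWithinAt)
    (fun t ht => (hd t ht).differentiableAt.differentiableWithinAt) fun t ht => ?_
  rw [(hd t ht).deriv]
  exact neg_nonpos.2 (hG _)

lemma IsSolutionOn.eqOn_Icc {G : V → V} (hG : ∀ x, 0 ≤ inner ℝ x (G x))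
    (hL : ∀ R : ℝ, ∃ C : NNReal, LipschitzOnWith C G (Metric.closedBall 0 R))
    {b : ℝ} {u v : ℝ → V} (hu : IsSolutionOn G (Icc 0 b) u) (hv : IsSolutionOn G (Icc 0 b) v)
    (h0 : u 0 = v 0) : EqOn u v (Icc 0 b) := by
  obtain ⟨C, hC⟩ := hL ‖u 0‖
  have hball : ∀ w : ℝ → V, IsSolutionOn G (Icc 0 b) w → w 0 = u 0 →
      ∀ t ∈ Ico 0 b, w t ∈ Metric.closedBall (0 : V) ‖u 0‖ := by
    intro w hw hw0 t ht
    rw [mem_closedBall_zero_iff, ← hw0]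
    exact norm_le_of_energy_le (hw.antitoneOn_energy (convex_Icc 0 b) hG
      ⟨le_rfl, ht.1.trans ht.2.le⟩ ⟨ht.1, ht.2.le⟩ ht.1)
  have hright : ∀ w : ℝ → V, IsSolutionOn G (Icc 0 b) w → ∀ t ∈ Ico 0 b,
      HasDerivWithinAt w (-G (w t)) (Ici t) t := fun w hw t ht =>
    ((hw t ⟨ht.1, ht.2.le⟩).mono (Icc_subset_Icc_left ht.1)).mono_of_mem_nhdsWithin
      (Icc_mem_nhdsGE ht.2)
  exact ODE_solution_unique_of_mem_Icc_right (v := fun _ x => -G x)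
    (s := fun _ => Metric.closedBall 0 ‖u 0‖) (K := C) (fun _ _ => hC.neg) hu.continuousOn
    (hright u hu) (hball u hu rfl) hv.continuousOn (hright v hv) (hball v hv h0.symm) h0

lemma exists_isSolutionOn_Icc [FiniteDimensional ℝ V] {G : V → V} (hG : ∀ x, 0 ≤ inner ℝ x (G x))
    (hL : ∀ R : ℝ, ∃ C : NNReal, LipschitzOnWith C G (Metric.closedBall 0 R)) (u₀ : V) (n : ℕ) :
    ∃ u : ℝ → V, u 0 = u₀ ∧ IsSolutionOn G (Icc 0 (n : ℝ)) u := by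
  have : CompleteSpace V := FiniteDimensional.complete ℝ V
  set R := ‖u₀‖ + 1
  have hR : 0 < R := by positivity
  obtain ⟨C, hC⟩ := hL R
  have hmem : ∀ x : V, radialTrunc R x ∈ Metric.closedBall (0 : V) R := fun x =>
    mem_closedBall_zero_iff.2 (norm_radialTrunc_le hR x)
  have hlip : LipschitzWith (C * 2) fun x => -G (radialTrunc R x) :=
    (lipschitzOnWith_univ.1 (hC.comp (lipschitzWith_radialTrunc hR).lipschitzOnWith
      fun x _ => hmem x)).neg
  set M : NNReal := ⟨‖G 0‖ + C * R, by positivity⟩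
  have hbd : ∀ x, ‖-G (radialTrunc R x)‖ ≤ M := by
    intro x
    have h := hC.dist_le_mul _ (hmem x) 0 (Metric.mem_closedBall_self hR.le)
    rw [dist_eq_norm, dist_zero_right] at h
    have h2 := norm_le_insert' (G (radialTrunc R x)) (G 0)
    have h3 := mul_le_mul_of_nonneg_left (norm_radialTrunc_le hR x) C.2
    rw [norm_neg]
    change _ ≤ ‖G 0‖ + C * R
    exact h2.trans (add_le_add_right (h.trans h3) _)
  have hn : (0 : ℝ) ≤ n := n.cast_nonneg
  have hPL : IsPicardLindelof (fun _ x => -G (radialTrunc R x))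
      (⟨0, le_rfl, hn⟩ : Icc (0 : ℝ) n) u₀ (M * n) 0 M (C * 2) :=
    IsPicardLindelof.of_time_independent (fun x _ => hbd x) hlip.lipschitzOnWith (by simp)
  obtain ⟨u, hu0, hu⟩ := hPL.exists_eq_forall_mem_Icc_hasDerivWithinAt₀
  have hu0' : u 0 = u₀ := hu0
  refine ⟨u, hu0', fun t ht => ?_⟩
  have hsol : IsSolutionOn (fun x => G (radialTrunc R x)) (Icc 0 (n : ℝ)) u := hu
  have hdiss : ∀ x : V, 0 ≤ inner ℝ x (G (radialTrunc R x)) := by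
    intro x
    have hc : 0 < R / max R ‖x‖ := div_pos hR (hR.trans_le (le_max_left _ _))
    have h := hG (radialTrunc R x)
    conv at h => rhs; arg 2; rw [radialTrunc]
    rw [real_inner_smul_left] at h
    exact nonneg_of_mul_nonneg_right h hc
  have hle := norm_le_of_energy_le (hsol.antitoneOn_energy (convex_Icc _ _) hdiss
    ⟨le_rfl, hn⟩ ht ht.1)
  have := hsol t ht
  simp only at this
  rwa [radialTrunc_of_norm_le hR (by rw [hu0'] at hle; linarith)] at this

/-- Global well-posedness: a dissipative vector field that is Lipschitz on bounded sets has global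
forward solutions. -/
theorem exists_isSolutionOn_Ici [FiniteDimensional ℝ V] {G : V → V} (hG : ∀ x, 0 ≤ inner ℝ x (G x))
    (hL : ∀ R : ℝ, ∃ C : NNReal, LipschitzOnWith C G (Metric.closedBall 0 R)) (u₀ : V) :
    ∃ u : ℝ → V, u 0 = u₀ ∧ IsSolutionOn G (Ici 0) u := by
  choose w hw0 hw using exists_isSolutionOn_Icc hG hL u₀
  have hagree : ∀ m n : ℕ, m ≤ n → ∀ t ∈ Icc (0 : ℝ) m, w m t = w n t := fun m n hmn =>
    (hw m).eqOn_Icc hG hL ((hw n).mono (Icc_subset_Icc_right (by exact_mod_cast hmn)))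
      ((hw0 m).trans (hw0 n).symm)
  have hval : ∀ (n : ℕ) (t : ℝ), t ∈ Icc (0 : ℝ) n → w ⌈t⌉₊ t = w n t := fun n t ht =>
    hagree _ _ (Nat.ceil_le.2 ht.2) t ⟨ht.1, Nat.le_ceil t⟩
  refine ⟨fun t => w ⌈t⌉₊ t, by simp [hw0], fun t ht => ?_⟩
  set n := ⌈t⌉₊ + 1
  have htn : t < n := (Nat.le_ceil t).trans_lt (by push_cast [n]; linarith)
  have hd := (hw n t ⟨ht, htn.le⟩).congr (f₁ := fun t => w ⌈t⌉₊ t) (hval n) (hval n t ⟨ht, htn.le⟩)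
  have hnh : Icc (0 : ℝ) n ∈ 𝓝[Ici 0] t := by
    filter_upwards [self_mem_nhdsWithin, mem_nhdsWithin_of_mem_nhds (Iio_mem_nhds htn)]
      with s h1 h2 using ⟨h1, h2.le⟩
  have := hd.mono_of_mem_nhdsWithin hnh
  rw [← hval n t ⟨ht, htn.le⟩] at this
  exact this

lemma IsSolutionOn.eqOn_Ico {G : V → V} (hG : ∀ x, 0 ≤ inner ℝ x (G x))
    (hL : ∀ R : ℝ, ∃ C : NNReal, LipschitzOnWith C G (Metric.closedBall 0 R))
    {τ : ℝ} {u v : ℝ → V} (hu : IsSolutionOn G (Ico 0 τ) u) (hv : IsSolutionOn G (Ico 0 τ) v)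
    (h0 : u 0 = v 0) : EqOn u v (Ico 0 τ) := fun t ht =>
  have hsub : Icc 0 t ⊆ Ico 0 τ := fun _ hs => ⟨hs.1, hs.2.trans_lt ht.2⟩
  (hu.mono hsub).eqOn_Icc hG hL (hv.mono hsub) h0 ⟨ht.1, le_rfl⟩

lemma exists_isSolutionOn_linear [FiniteDimensional ℝ V] (a : V →ₗ[ℝ] V) (u₀ : V) :
    ∃ φ : ℝ → V, φ 0 = u₀ ∧ IsSolutionOn a univ φ := by
  have : CompleteSpace V := FiniteDimensional.complete ℝ V
  let a' : V →L[ℝ] V := -LinearMap.toContinuousLinearMap a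
  refine ⟨fun t => NormedSpace.exp (t • a') u₀, by simp, fun t _ => ?_⟩
  have h := (hasDerivAt_exp_smul_const' a' t).clm_apply (hasDerivAt_const t u₀)
  refine (h.congr_deriv ?_).hasDerivWithinAt
  simp [a']

lemma IsSolutionOn.energy_sub {G : V → V} (hGc : Continuous G) {u : ℝ → V}
    (hu : IsSolutionOn G (Ici 0) u) {T : ℝ} (hT : 0 ≤ T) :
    ∫ t in (0 : ℝ)..T, inner ℝ (u t) (G (u t)) = energy u 0 - energy u T := by
  have hsub : Icc 0 T ⊆ Ici (0 : ℝ) := fun t ht => ht.1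
  have hc : ContinuousOn u (Icc 0 T) := hu.continuousOn.mono hsub
  have hci : ContinuousOn (fun t => -inner ℝ (u t) (G (u t))) (Icc 0 T) :=
    (hc.inner (hGc.comp_continuousOn hc)).neg
  have := intervalIntegral.integral_eq_sub_of_hasDerivAt_of_le hT (f := energy u)
    (fun t ht => ((hu.hasDerivWithinAt_energy (hsub ht)).continuousWithinAt).mono hsub)
    (fun t ht => (hu.hasDerivWithinAt_energy ht.1.le).hasDerivAt (Ici_mem_nhds ht.1))
    (hci.intervalIntegrable_of_Icc hT)
  rw [intervalIntegral.integral_neg] at this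
  linarith

/-! ### Transfer of the observability to perturbed equations -/

/-- If `w' + a w + p = 0` with `a` skew-symmetric and `w(0) = 0`, then `w` is controlled by the
`L²` norm of `p`. The maximum of `‖w‖²` is absorbed by Young's inequality. -/
lemma norm_sq_le_of_perturbation (a : V →ₗ[ℝ] V) (ha : ∀ v, inner ℝ v (a v) = 0)
    {T : ℝ} (hT : 0 < T) {w p : ℝ → V} (hp : ContinuousOn p (Icc 0 T)) (hw0 : w 0 = 0)
    (hw : ∀ t ∈ Icc 0 T, HasDerivWithinAt w (-(a (w t) + p t)) (Icc 0 T) t) :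
    ∀ t ∈ Icc 0 T, ‖w t‖ ^ 2 ≤ 4 * T * ∫ s in (0 : ℝ)..T, ‖p s‖ ^ 2 := by
  have hwc : ContinuousOn w (Icc 0 T) := fun t ht => (hw t ht).continuousWithinAt
  obtain ⟨τ, hτ, hmax⟩ := isCompact_Icc.exists_isMaxOn (nonempty_Icc.2 hT.le)
    (hwc.norm.pow 2)
  have hmax' : ∀ t ∈ Icc 0 T, ‖w t‖ ^ 2 ≤ ‖w τ‖ ^ 2 := fun t ht => hmax ht
  have hsub : Icc 0 τ ⊆ Icc 0 T := Icc_subset_Icc_right hτ.2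
  have hcd : ContinuousOn (fun t => -(2 * inner ℝ (w t) (p t))) (Icc 0 T) :=
    (continuousOn_const.mul (hwc.inner hp)).neg
  have hd : ∀ t ∈ Icc 0 T, HasDerivWithinAt (fun t => ‖w t‖ ^ 2)
      (-(2 * inner ℝ (w t) (p t))) (Icc 0 T) t := fun t ht => by
    refine (hw t ht).norm_sq.congr_deriv ?_
    rw [inner_neg_right, inner_add_right, ha]
    ring
  have hint := intervalIntegral.integral_eq_sub_of_hasDerivAt_of_le hτ.1
    (fun t ht => (hd t (hsub ht)).continuousWithinAt.mono hsub)
    (fun t ht => (hd t ⟨ht.1.le, ht.2.le.trans hτ.2⟩).hasDerivAt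
      (Icc_mem_nhds ht.1 (ht.2.trans_le hτ.2)))
    ((hcd.mono hsub).intervalIntegrable_of_Icc hτ.1)
  have hpc : ContinuousOn (fun t => ‖p t‖ ^ 2) (Icc 0 T) := hp.norm.pow 2
  set m := ‖w τ‖ ^ 2
  have hm : 0 ≤ m := by positivity
  have hle : ∫ t in (0 : ℝ)..τ, -(2 * inner ℝ (w t) (p t)) ≤
      ∫ t in (0 : ℝ)..τ, (m / (2 * T) + 2 * T * ‖p t‖ ^ 2) := by
    refine intervalIntegral.integral_mono_on hτ.1 ((hcd.mono hsub).intervalIntegrable_of_Icc hτ.1)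
      ((continuousOn_const.add (continuousOn_const.mul (hpc.mono hsub))).intervalIntegrable_of_Icc
        hτ.1) fun t ht => ?_
    have h1 := (neg_le_abs _).trans (abs_real_inner_le_norm (w t) (p t))
    have h2 : 2 * (‖w t‖ * ‖p t‖) ≤ ‖w t‖ ^ 2 / (2 * T) + 2 * T * ‖p t‖ ^ 2 := by
      have : ‖w t‖ ^ 2 / (2 * T) + 2 * T * ‖p t‖ ^ 2 - 2 * (‖w t‖ * ‖p t‖) =
          (‖w t‖ - 2 * T * ‖p t‖) ^ 2 / (2 * T) := by
        field_simp
        ring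
      have h3 : 0 ≤ (‖w t‖ - 2 * T * ‖p t‖) ^ 2 / (2 * T) := by positivity
      linarith
    have h4 : ‖w t‖ ^ 2 / (2 * T) ≤ m / (2 * T) :=
      div_le_div_of_nonneg_right (hmax' t (hsub ht)) (by positivity)
    linarith
  have hpi : IntervalIntegrable (fun t => 2 * T * ‖p t‖ ^ 2) volume 0 τ :=
    (continuousOn_const.mul (hpc.mono hsub)).intervalIntegrable_of_Icc hτ.1
  rw [hint, hw0, norm_zero, intervalIntegral.integral_add intervalIntegrable_const hpi,
    intervalIntegral.integral_const, intervalIntegral.integral_const_mul, smul_eq_mul] at hle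
  have hmono : ∫ t in (0 : ℝ)..τ, ‖p t‖ ^ 2 ≤ ∫ t in (0 : ℝ)..T, ‖p t‖ ^ 2 := by
    refine intervalIntegral.integral_mono_interval le_rfl hτ.1 hτ.2
      (Eventually.of_forall fun t => by positivity) (hpc.intervalIntegrable_of_Icc hT.le)
  have h5 : (τ - 0) * (m / (2 * T)) ≤ m / 2 := by
    have : (τ - 0) * (m / (2 * T)) ≤ T * (m / (2 * T)) :=
      mul_le_mul_of_nonneg_right (by linarith [hτ.2]) (by positivity)
    refine this.trans_eq ?_
    field_simp
  have h6 := mul_le_mul_of_nonneg_left hmono (by positivity : 0 ≤ 2 * T)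
  have h7 : m ≤ 4 * T * ∫ s in (0 : ℝ)..T, ‖p s‖ ^ 2 := by
    change m - 0 ^ 2 ≤ _ at hle
    linarith
  exact fun t ht => (hmax' t ht).trans h7

/-- The observation `∫ ⟨D φ, φ⟩` of the solution of `φ' + a φ = 0` is controlled by that of a
solution of `u' + a u + p = 0` with the same initial datum. -/
lemma observation_le [FiniteDimensional ℝ V] (a D : V →ₗ[ℝ] V) (ha : ∀ v, inner ℝ v (a v) = 0)
    {N : ℝ} (hD : ∀ v, 0 ≤ inner ℝ (D v) v) (hDN : ∀ v, inner ℝ (D v) v ≤ N * ‖v‖ ^ 2)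
    (hN : 0 ≤ N) {T : ℝ} (hT : 0 < T) {u φ p : ℝ → V} (hp : ContinuousOn p (Icc 0 T))
    (hφ : IsSolutionOn a univ φ) (h0 : φ 0 = u 0)
    (hu : ∀ t ∈ Icc 0 T, HasDerivWithinAt u (-(a (u t) + p t)) (Icc 0 T) t) :
    ∫ t in (0 : ℝ)..T, inner ℝ (D (φ t)) (φ t) ≤
      ∫ t in (0 : ℝ)..T, (2 * inner ℝ (D (u t)) (u t) + 8 * N * T ^ 2 * ‖p t‖ ^ 2) := by
  have huc : ContinuousOn u (Icc 0 T) := fun t ht => (hu t ht).continuousWithinAt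
  have hφc : ContinuousOn φ (Icc 0 T) := hφ.continuousOn.mono (subset_univ _)
  have hDc : Continuous D := D.continuous_of_finiteDimensional
  have hpc : ContinuousOn (fun t => ‖p t‖ ^ 2) (Icc 0 T) := hp.norm.pow 2
  have hw := norm_sq_le_of_perturbation a ha hT (w := fun t => u t - φ t) hp (by simp [h0])
    fun t ht => by
      refine ((hu t ht).sub ((hφ t trivial).mono (subset_univ _))).congr_deriv ?_
      rw [map_sub]
      abel
  set I := ∫ s in (0 : ℝ)..T, ‖p s‖ ^ 2
  have hDuc : ContinuousOn (fun t => 2 * inner ℝ (D (u t)) (u t)) (Icc 0 T) :=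
    continuousOn_const.mul ((hDc.comp_continuousOn huc).inner huc)
  have hDφc : ContinuousOn (fun t => inner ℝ (D (φ t)) (φ t)) (Icc 0 T) :=
    (hDc.comp_continuousOn hφc).inner hφc
  have hle : ∫ t in (0 : ℝ)..T, inner ℝ (D (φ t)) (φ t) ≤
      ∫ t in (0 : ℝ)..T, (2 * inner ℝ (D (u t)) (u t) + 8 * N * T * I) := by
    refine intervalIntegral.integral_mono_on hT.le (hDφc.intervalIntegrable_of_Icc hT.le)
      ((hDuc.add continuousOn_const).intervalIntegrable_of_Icc hT.le) fun t ht => ?_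
    have h1 := hD (u t + (u t - φ t))
    have h2 := (hDN (u t - φ t)).trans (mul_le_mul_of_nonneg_left (hw t ht) hN)
    have h3 : inner ℝ (D (φ t)) (φ t) + inner ℝ (D (u t + (u t - φ t))) (u t + (u t - φ t)) =
        2 * inner ℝ (D (u t)) (u t) + 2 * inner ℝ (D (u t - φ t)) (u t - φ t) := by
      simp only [map_add, map_sub, inner_add_left, inner_add_right, inner_sub_left,
        inner_sub_right]
      ring
    linarith
  refine hle.trans_eq ?_
  have hi := hDuc.intervalIntegrable_of_Icc (μ := volume) hT.le
  have hpi : IntervalIntegrable (fun t => 8 * N * T ^ 2 * ‖p t‖ ^ 2) volume 0 T :=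
    (continuousOn_const.mul hpc).intervalIntegrable_of_Icc hT.le
  rw [intervalIntegral.integral_add hi intervalIntegrable_const,
    intervalIntegral.integral_add hi hpi,
    intervalIntegral.integral_const_mul (8 * N * T ^ 2), intervalIntegral.integral_const,
    smul_eq_mul]
  ring

/-- Cauchy-Schwarz for a nonnegative symmetric operator. -/
lemma norm_sq_le_mul_inner (S : V →ₗ[ℝ] V) (hS : ∀ x y, inner ℝ (S x) y = inner ℝ x (S y))
    (hS0 : ∀ x, 0 ≤ inner ℝ (S x) x) {N : ℝ} (hN : 0 ≤ N)
    (hSN : ∀ x, inner ℝ (S x) x ≤ N * ‖x‖ ^ 2) (x : V) :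
    ‖S x‖ ^ 2 ≤ N * inner ℝ (S x) x := by
  have key : ∀ c : ℝ, 2 * c * ‖S x‖ ^ 2 ≤ inner ℝ (S x) x + c ^ 2 * (N * ‖S x‖ ^ 2) := by
    intro c
    have h1 := hS0 (x - c • S x)
    have h2 := mul_le_mul_of_nonneg_left (hSN (S x)) (sq_nonneg c)
    simp only [map_sub, map_smul, inner_sub_left, inner_sub_right, real_inner_smul_left,
      real_inner_smul_right] at h1
    rw [hS (S x) x, real_inner_self_eq_norm_sq] at h1
    linarith
  rcases hN.eq_or_lt with rfl | hN
  · have h1 := key 1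
    have h2 := hSN x
    linarith
  · have h1 := key (1 / N)
    have h2 : (1 / N) ^ 2 * (N * ‖S x‖ ^ 2) = 1 / N * ‖S x‖ ^ 2 := by
      field_simp
    have h3 : N * (1 / N * ‖S x‖ ^ 2) = ‖S x‖ ^ 2 := by
      field_simp
    have h4 : 1 / N * ‖S x‖ ^ 2 ≤ inner ℝ (S x) x := by linarith
    have := mul_le_mul_of_nonneg_left h4 hN.le
    linarith

end DissipativeODE

/-! ### The pointwise weighted inequality -/

namespace IsDampingProfile

variable {g : ℝ → ℝ} {s₀ : ℝ}

lemma apply_invFun (hg : IsDampingProfile g s₀) {y : ℝ} (hy : y ∈ Icc 0 1) :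
    g (Function.invFun g y) = y := by
  obtain ⟨x₁, hx₁⟩ := hg.one_mem_range
  have hx₁0 : 0 ≤ x₁ := by
    by_contra! h
    have := hg.strictMono h
    rw [hx₁, hg.map_zero] at this
    linarith
  have h := intermediate_value_Icc hx₁0 hg.contDiff.continuous.continuousOn
  rw [hg.map_zero, hx₁] at h
  obtain ⟨x, -, hx⟩ := h hy
  exact Function.invFun_eq ⟨x, hx⟩

/-- The growth conditions turn Young's inequality for `H` into a bound of `w (x² + y²)` by the
dissipation `x y` and the convex conjugate of `H`. Young's inequality applies to `x²` and
`(y / c₂)²` where `|x| < min s₀ (g s₀)`; elsewhere `x²` and `y²` are bounded by multiples of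
`x y`. -/
lemma exists_weighted_bound (hg : IsDampingProfile g s₀) {c₁ c₂ : ℝ} (hc₁ : 0 < c₁)
    (hc₂ : 0 < c₂) :
    ∃ C, 1 ≤ C ∧ ∀ w x y : ℝ, 0 < w → 0 ≤ x * y →
      (|x| ≤ 1 → c₁ * g |x| ≤ |y| ∧ |y| ≤ c₂ * Function.invFun g |x|) →
      (1 ≤ |x| → c₁ * |x| ≤ |y| ∧ |y| ≤ c₂ * |x|) →
      w * (x ^ 2 + y ^ 2) ≤ C * ((1 + w) * (x * y) + conjH g s₀ w) := by
  set η := min s₀ (g s₀)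
  have hη : 0 < η := lt_min hg.pos (hg.map_pos hg.pos)
  set e := Function.invFun g 1
  have hge : g e = 1 := hg.apply_invFun ⟨zero_le_one, le_rfl⟩
  have he : 0 < e := by
    refine hg.strictMono.lt_iff_lt.1 ?_
    rw [hg.map_zero, hge]
    exact one_pos
  have hgη := hg.map_pos hη
  refine ⟨1 / c₁ + c₂ + 1 / (c₁ * g η) + c₂ * e / η + 1 + c₂ ^ 2, ?_, ?_⟩
  · have : 0 ≤ 1 / c₁ + c₂ + 1 / (c₁ * g η) + c₂ * e / η + c₂ ^ 2 := by positivity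
    linarith
  intro w x y hw hxy hsmall hlarge
  have hconj := hg.conjH_nonneg w
  have hxy' : x * y = |x| * |y| := by rw [← abs_mul, abs_of_nonneg hxy]
  have hm : 0 ≤ |x| * |y| := by positivity
  rw [hxy', ← sq_abs x, ← sq_abs y]
  have p1 : 0 < 1 / c₁ := by positivity
  have p2 : 0 < 1 / (c₁ * g η) := by positivity
  have p3 : 0 < c₂ * e / η := by positivity
  have p4 : 0 < c₂ ^ 2 := by positivity
  -- a bound without weight is enough, as `w ≤ 1 + w`
  have hfree : ∀ a b : ℝ, |x| ^ 2 ≤ a * (|x| * |y|) → |y| ^ 2 ≤ b * (|x| * |y|) →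
      a + b ≤ 1 / c₁ + c₂ + 1 / (c₁ * g η) + c₂ * e / η + 1 + c₂ ^ 2 →
      w * (|x| ^ 2 + |y| ^ 2) ≤ (1 / c₁ + c₂ + 1 / (c₁ * g η) + c₂ * e / η + 1 + c₂ ^ 2) *
        ((1 + w) * (|x| * |y|) + conjH g s₀ w) := by
    intro a b ha hb hab
    set C := 1 / c₁ + c₂ + 1 / (c₁ * g η) + c₂ * e / η + 1 + c₂ ^ 2
    have hC : 0 < C := by positivity
    have h1 : |x| ^ 2 + |y| ^ 2 ≤ C * (|x| * |y|) :=
      calc _ ≤ (a + b) * (|x| * |y|) := by linarith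
        _ ≤ _ := mul_le_mul_of_nonneg_right hab hm
    have h2 := mul_le_mul_of_nonneg_left h1 hw.le
    have h3 : 0 ≤ C * (|x| * |y|) := by positivity
    have h4 : 0 ≤ C * conjH g s₀ w := by positivity
    linarith
  rcases le_or_gt 1 |x| with h1 | h1
  · obtain ⟨hl, hu⟩ := hlarge h1
    refine hfree (1 / c₁) c₂ ?_ ?_ (by linarith)
    · rw [one_div_mul_eq_div, le_div_iff₀ hc₁]
      nlinarith [abs_nonneg x]
    · nlinarith [abs_nonneg y]
  obtain ⟨hl, hu⟩ := hsmall h1.le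
  rcases le_or_gt η |x| with h2 | h2
  · refine hfree (1 / (c₁ * g η)) (c₂ * e / η) ?_ ?_ (by linarith)
    · have h3 : c₁ * g η ≤ |y| :=
        (mul_le_mul_of_nonneg_left (hg.strictMono.monotone h2) hc₁.le).trans hl
      rw [one_div_mul_eq_div, le_div_iff₀ (mul_pos hc₁ hgη)]
      have : |x| ^ 2 ≤ |x| := by nlinarith [abs_nonneg x]
      exact mul_le_mul this h3 (mul_pos hc₁ hgη).le (abs_nonneg x)
    · have h3 : Function.invFun g |x| ≤ e := by
        refine hg.strictMono.le_iff_le.1 ?_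
        rw [hge, hg.apply_invFun ⟨abs_nonneg x, h1.le⟩]
        exact h1.le
      have h4 : |y| ≤ c₂ * e := hu.trans (mul_le_mul_of_nonneg_left h3 hc₂.le)
      rw [div_mul_eq_mul_div, le_div_iff₀ hη, sq, mul_assoc]
      calc |y| * (|y| * η) ≤ (c₂ * e) * (|y| * |x|) := by gcongr
        _ = _ := by ring
  · have hx2 : |x| ^ 2 ∈ Icc 0 (s₀ ^ 2) :=
      ⟨by positivity, pow_le_pow_left₀ (abs_nonneg x) (h2.le.trans (min_le_left _ _)) 2⟩
    have hY1 := hg.mul_le_dampingH_add_conjH w hx2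
    rw [dampingH_sq (abs_nonneg x)] at hY1
    have hY1' : |x| * g |x| ≤ 1 / c₁ * (|x| * |y|) := by
      rw [one_div_mul_eq_div, le_div_iff₀ hc₁, mul_assoc]
      exact mul_le_mul_of_nonneg_left (by linarith) (abs_nonneg x)
    set z := |y| / c₂
    have hz : 0 ≤ z := by positivity
    have hyz : |y| = c₂ * z := by
      simp only [z]
      field_simp
    have hgz : g z ≤ |x| := by
      rw [← hg.apply_invFun ⟨abs_nonneg x, h1.le⟩]
      refine hg.strictMono.monotone ?_
      exact (div_le_iff₀' hc₂).2 hu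
    have hzs : z ≤ s₀ := hg.strictMono.le_iff_le.1
      (hgz.trans (h2.le.trans (min_le_right _ _)))
    have hY2 := hg.mul_le_dampingH_add_conjH w (s := z ^ 2)
      ⟨by positivity, pow_le_pow_left₀ hz hzs 2⟩
    rw [dampingH_sq hz] at hY2
    have hY2' : z * g z ≤ z * |x| := mul_le_mul_of_nonneg_left hgz hz
    have hY3 : w * |y| ^ 2 ≤ c₂ * (|x| * |y|) + c₂ ^ 2 * conjH g s₀ w := by
      have := mul_le_mul_of_nonneg_left (hY2.trans (add_le_add_left hY2' _)) p4.le
      rw [hyz]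
      linarith
    set C := 1 / c₁ + c₂ + 1 / (c₁ * g η) + c₂ * e / η + 1 + c₂ ^ 2
    have hm' : 0 ≤ w * (|x| * |y|) := by positivity
    have hC1 : (1 / c₁ + c₂) * (|x| * |y|) ≤ C * ((1 + w) * (|x| * |y|)) :=
      mul_le_mul (by linarith) (by linarith) hm (by positivity)
    have hC2 : (1 + c₂ ^ 2) * conjH g s₀ w ≤ C * conjH g s₀ w :=
      mul_le_mul_of_nonneg_right (by linarith) hconj
    linarith

end IsDampingProfile

/-! ### Skew-symmetry of the discretized generator -/

section Operators

variable {X : Type*} [NormedAddCommGroup X] [InnerProductSpace ℝ X]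

lemma IsSkewAdjointOp.inner_self [CompleteSpace X] {A : X →ₗ.[ℝ] X}
    (hA : IsSkewAdjointOp A) (u : A.domain) :
    inner ℝ (A u) (u : X) = 0 := by
  have h := LinearPMap.adjoint_isFormalAdjoint hA.1
  rw [hA.2] at h
  have h1 : inner ℝ (-(A u)) (u : X) = inner ℝ (u : X) (A u) := h u u
  rw [inner_neg_left, real_inner_comm (A u)] at h1
  linarith

lemma IsResolvent.comm {A : X →ₗ.[ℝ] X} {m n : ℝ} {R S : X →L[ℝ] X} (hR : IsResolvent A m R)
    (hS : IsResolvent A n S) (x : X) : R (S x) = S (R x) := by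
  -- the resolvent identity, in both orders
  have key : ∀ {m n : ℝ} {R S : X →L[ℝ] X}, IsResolvent A m R → IsResolvent A n S →
      S x = R x + (m - n) • R (S x) := by
    intro m n R S hR hS
    obtain ⟨hd, hx⟩ := hS.1 x
    have h := hR.2 ⟨S x, hd⟩
    have e : m • S x - A ⟨S x, hd⟩ = x + (m - n) • S x := by
      conv_rhs => enter [1]; rw [← hx]
      module
    rw [e, map_add, map_smul] at h
    exact h.symm
  have h1 := key hR hS
  have h2 := key hS hR
  rcases eq_or_ne m n with rfl | hmn
  · have hRS : R = S := by
      ext y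
      obtain ⟨hd, hy⟩ := hS.1 y
      have h := hR.2 ⟨S y, hd⟩
      simp only [hy] at h
      exact h
    rw [hRS]
  · have h3 : (m - n) • R (S x) = (m - n) • S (R x) := by
      calc (m - n) • R (S x) = S x - R x := by
            rw [eq_sub_iff_add_eq']
            exact h1.symm
        _ = (m - n) • S (R x) := by
          nth_rewrite 1 [h2]
          rw [← neg_sub n m, neg_smul]
          abel
    exact smul_right_injective X (sub_ne_zero.2 hmn) h3

lemma resolventOp_eq_zero_or (A : X →ₗ.[ℝ] X) (m : ℝ) :
    resolventOp A m = 0 ∨ IsResolvent A m (resolventOp A m) := by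
  unfold resolventOp
  split_ifs with h
  · exact Or.inr h.choose_spec
  · exact Or.inl rfl

lemma resolventOp_comm (A : X →ₗ.[ℝ] X) (m n : ℝ) :
    resolventOp A m ∘L resolventOp A n = resolventOp A n ∘L resolventOp A m := by
  rcases resolventOp_eq_zero_or A m with h | h
  · simp [h]
  rcases resolventOp_eq_zero_or A n with h' | h'
  · simp [h']
  ext x
  exact h.comm h' x

lemma invSqrtOp_comm [CompleteSpace X] (A : X →ₗ.[ℝ] X) (m : ℝ) :
    invSqrtOp A ∘L resolventOp A m = resolventOp A m ∘L invSqrtOp A := by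
  unfold invSqrtOp
  rw [ContinuousLinearMap.smul_comp, ContinuousLinearMap.comp_smul]
  congr 1
  set f : ℝ → X →L[ℝ] X := fun l => (l ^ (-(1 / 2) : ℝ)) • resolventOp A (l + 1)
  by_cases hf : IntegrableOn f (Ioi 0)
  · have h1 := ((ContinuousLinearMap.compL ℝ X X X).flip (resolventOp A m)).integral_comp_comm hf
    have h2 := ((ContinuousLinearMap.compL ℝ X X X) (resolventOp A m)).integral_comp_comm hf
    simp only [ContinuousLinearMap.flip_apply, ContinuousLinearMap.compL_apply] at h1 h2
    rw [← h1, ← h2]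
    congr 1
    ext1 l
    simp only [f]
    rw [ContinuousLinearMap.smul_comp, ContinuousLinearMap.comp_smul, resolventOp_comm]
  · rw [integral_undef hf]
    simp

/-- `(1 - A)^{-1/2}` commutes with the resolvents of `A`, hence maps `D(A)` into itself. (Were no
resolvent to exist, `invSqrtOp A` would vanish.) -/
lemma dense_invSqrtOp_mem_domain [CompleteSpace X] {A : X →ₗ.[ℝ] X}
    (hA : Dense (A.domain : Set X)) :
    Dense {x | invSqrtOp A x ∈ A.domain} := by
  by_cases h : ∃ l > (0 : ℝ), resolventOp A (l + 1) ≠ 0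
  · obtain ⟨l, -, hl⟩ := h
    have hR := (resolventOp_eq_zero_or A (l + 1)).resolve_left hl
    refine hA.mono fun u hu => ?_
    have h1 := hR.2 ⟨u, hu⟩
    have h2 := congrArg (fun T => T ((l + 1) • u - A ⟨u, hu⟩)) (invSqrtOp_comm A (l + 1))
    simp only [ContinuousLinearMap.comp_apply] at h2
    simp only at h1
    rw [mem_ofPred_eq, ← h1, h2]
    exact (hR.1 _).1
  · push Not at h
    have h0 : invSqrtOp A = 0 := by
      rw [invSqrtOp, setIntegral_congr_fun measurableSet_Ioi (g := fun _ => 0) fun l hl => by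
        simp [h l hl]]
      simp
    simp [h0]

lemma IsCanonicalExtension.apply_self [CompleteSpace X] {A : X →ₗ.[ℝ] X}
    {A' : HalfSpace A →ₗ[ℝ] NegHalfSpace A} (hA : IsSkewAdjointOp A)
    (hA' : IsCanonicalExtension A A') (u : HalfSpace A) : (A' u).1 u = 0 := by
  obtain ⟨⟨M, hM⟩, hext⟩ := hA'
  let β : X →ₗ[ℝ] X →ₗ[ℝ] ℝ := LinearMap.mk₂ ℝ (fun x y => (A' (toHalf A x)).1 (toHalf A y))
    (fun x x' y => by simp) (fun c x y => by simp) (fun x y y' => by simp)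
    (fun c x y => by simp)
  let βc := β.mkContinuous₂ M hM
  have hβ : Continuous fun x => βc x x := by fun_prop
  have hzero : (fun x => βc x x) = fun _ => 0 := by
    refine hβ.ext_on (dense_invSqrtOp_mem_domain hA.1) continuous_const fun x hx => ?_
    change (A' (toHalf A x)).1 (toHalf A x) = 0
    rw [hext (toHalf A x) hx]
    exact hA.inner_self ⟨invSqrtOp A x, hx⟩
  obtain ⟨x, hx⟩ := LinearMap.surjective_rangeRestrict (invSqrtOp A : X →ₗ[ℝ] X) u
  rw [← hx]
  exact congrFun hzero x

variable {V : Type*} [NormedAddCommGroup V] [InnerProductSpace ℝ V] [FiniteDimensional ℝ V]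

lemma inner_samplingOp (A : X →ₗ.[ℝ] X) (P' : V →ₗ[ℝ] HalfSpace A) (l : NegHalfSpace A) (v : V) :
    inner ℝ (samplingOp A P' l) v = l.1 (P' v) := by
  have : CompleteSpace V := FiniteDimensional.complete ℝ V
  exact InnerProductSpace.toDual_symm_apply

lemma inner_sample (A : X →ₗ.[ℝ] X) (P' : V →ₗ[ℝ] HalfSpace A) (x : X) (v : V) :
    inner ℝ (sample A P' x) v = inner ℝ x (P' v : X) :=
  inner_samplingOp A P' (toNegHalf A x) v

lemma inner_discreteA_self [CompleteSpace X] {A : X →ₗ.[ℝ] X}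
    {A' : HalfSpace A →ₗ[ℝ] NegHalfSpace A}
    (hA : IsSkewAdjointOp A) (hA' : IsCanonicalExtension A A') (P' : V →ₗ[ℝ] HalfSpace A) (v : V) :
    inner ℝ v (discreteA A A' P' v) = 0 := by
  rw [real_inner_comm]
  exact (inner_samplingOp A P' _ v).trans (hA'.apply_self hA (P' v))

lemma inner_discreteB (A : X →ₗ.[ℝ] X) (B : X →L[ℝ] X) (P' : V →ₗ[ℝ] HalfSpace A) (v w : V) :
    inner ℝ (discreteB A B P' v) w = inner ℝ (B (P' v)) (P' w : X) :=
  inner_sample A P' _ w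

/-! ### The damping operator as a multiplication operator -/

variable {Ω : Type*} [MeasurableSpace Ω] {μ : Measure Ω}

lemma integrable_damping {B : X →L[ℝ] X} {b : Ω → ℝ} {U : Lp ℝ 2 μ ≃ₗᵢ[ℝ] X}
    (hb : ∀ f : Lp ℝ 2 μ, (U.symm (B (U f)) : Ω → ℝ) =ᵐ[μ] fun x => b x * f x)
    (f r : Lp ℝ 2 μ) : Integrable (fun x => b x * (f x * r x)) μ := by
  refine (L2.integrable_inner (𝕜 := ℝ) r (U.symm (B (U f)))).congr ?_
  filter_upwards [hb f] with x hx
  rw [hx]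
  simp only [RCLike.inner_apply, conj_trivial]
  ring

lemma inner_damping {B : X →L[ℝ] X} {b : Ω → ℝ} {U : Lp ℝ 2 μ ≃ₗᵢ[ℝ] X}
    (hb : ∀ f : Lp ℝ 2 μ, (U.symm (B (U f)) : Ω → ℝ) =ᵐ[μ] fun x => b x * f x)
    (f r : Lp ℝ 2 μ) : inner ℝ (B (U f)) (U r) = ∫ x, b x * (f x * r x) ∂μ := by
  have h : inner ℝ (B (U f)) (U r) = inner ℝ (U.symm (B (U f))) r := by
    rw [← U.inner_map_map, U.apply_symm_apply]
  rw [h, L2.inner_def]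
  refine integral_congr_ae ?_
  filter_upwards [hb f] with x hx
  rw [hx]
  simp only [RCLike.inner_apply, conj_trivial]
  ring

/-- Test `B` on the constant function `1`. -/
lemma integral_damping_le [IsProbabilityMeasure μ] {B : X →L[ℝ] X} {b : Ω → ℝ}
    {U : Lp ℝ 2 μ ≃ₗᵢ[ℝ] X}
    (hb : ∀ f : Lp ℝ 2 μ, (U.symm (B (U f)) : Ω → ℝ) =ᵐ[μ] fun x => b x * f x) :
    Integrable b μ ∧ ∫ x, b x ∂μ ≤ ‖B‖ := by
  set e : Lp ℝ 2 μ := Lp.const 2 μ (1 : ℝ)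
  have he : e =ᵐ[μ] fun _ => (1 : ℝ) := Lp.coeFn_const (p := 2) (μ := μ) (1 : ℝ)
  have hbe : (fun x => b x * (e x * e x)) =ᵐ[μ] b := by
    filter_upwards [he] with x hx
    rw [hx]
    ring
  have hn : ‖U e‖ = 1 := by
    rw [U.norm_map]
    simp [e, Lp.norm_const]
  refine ⟨(integrable_damping hb e e).congr hbe, ?_⟩
  rw [← integral_congr_ae hbe, ← inner_damping hb]
  refine (real_inner_le_norm _ _).trans ?_
  have := B.le_opNorm (U e)
  rw [hn] at this ⊢
  linarith

end Operators

/-! ### Energy decay along one observation period -/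

section Step

variable {V : Type*} [NormedAddCommGroup V] [InnerProductSpace ℝ V]

lemma continuous_of_lipschitzOn_balls {V V' : Type*} [NormedAddCommGroup V]
    [NormedAddCommGroup V'] {f : V → V'}
    (hf : ∀ R : ℝ, ∃ C : NNReal, LipschitzOnWith C f (Metric.closedBall 0 R)) : Continuous f := by
  refine continuous_iff_continuousAt.2 fun x => ?_
  obtain ⟨C, hC⟩ := hf (‖x‖ + 1)
  refine hC.continuousOn.continuousAt (mem_of_superset
    (Metric.isOpen_ball.mem_nhds (?_ : x ∈ Metric.ball 0 (‖x‖ + 1))) Metric.ball_subset_closedBall)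
  rw [mem_ball_zero_iff]
  linarith

/-- Observability of the conservative equation, transferred to the damped equation and combined
with the weighted inequality between the observed quantities and the dissipation. -/
lemma weighted_energy_step [FiniteDimensional ℝ V] (a S W : V →ₗ[ℝ] V) {f : V → V}
    (ha : ∀ v, inner ℝ v (a v) = 0)
    (hS : ∀ x y, inner ℝ (S x) y = inner ℝ x (S y)) (hS0 : ∀ x, 0 ≤ inner ℝ (S x) x)
    (hW : ∀ x y, inner ℝ (W x) y = inner ℝ x (W y)) (hW0 : ∀ x, 0 ≤ inner ℝ (W x) x)
    {β K : ℝ} (hβ : 0 ≤ β) (hK : 0 ≤ K) (hSβ : ∀ x, inner ℝ (S x) x ≤ β * ‖x‖ ^ 2)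
    (hWK : ∀ x, inner ℝ (W x) x ≤ K * ‖x‖ ^ 2) (hf : Continuous f)
    {T CT : ℝ} (hT : 0 < T)
    (hobs : ∀ φ : ℝ → V, IsSolutionOn a univ φ →
      CT * energy φ 0 ≤ ∫ t in (0 : ℝ)..T, (inner ℝ (S (φ t)) (φ t) + inner ℝ (W (φ t)) (φ t)))
    {u : ℝ → V} (hu : IsSolutionOn (fun v => a v + S (f v) + W v) (Ici 0) u)
    {C w c : ℝ} (hC : 1 ≤ C) (hw : 0 < w)
    (hfw : ∀ v, w * (inner ℝ (S v) v + inner ℝ (S (f v)) (f v)) ≤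
      C * ((1 + w) * inner ℝ v (S (f v)) + c)) :
    w * (CT * energy u 0) ≤
      16 * C * (T ^ 2 * (β + K) ^ 2 + 1) * ((1 + w) * (energy u 0 - energy u T) + T * c) := by
  set M := T ^ 2 * (β + K) ^ 2 + 1
  have hac : Continuous a := a.continuous_of_finiteDimensional
  have hSc : Continuous S := S.continuous_of_finiteDimensional
  have hWc : Continuous W := W.continuous_of_finiteDimensional
  have hGc : Continuous fun v => a v + S (f v) + W v := by fun_prop
  have huc : ContinuousOn u (Icc 0 T) := hu.continuousOn.mono fun t ht => ht.1
  have hpc : ContinuousOn (fun t => S (f (u t)) + W (u t)) (Icc 0 T) := by fun_prop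
  obtain ⟨φ, hφ0, hφ⟩ := exists_isSolutionOn_linear a (u 0)
  have h1 := hobs φ hφ
  have hE : energy φ 0 = energy u 0 := by simp only [energy, hφ0]
  have h2 := observation_le a (S + W) ha (N := β + K)
    (fun v => by rw [LinearMap.add_apply, inner_add_left]; exact add_nonneg (hS0 v) (hW0 v))
    (fun v => by rw [LinearMap.add_apply, inner_add_left]; linarith [hSβ v, hWK v])
    (by positivity) hT hpc hφ hφ0 fun t ht => by
      have := (hu t ht.1).mono (fun s hs => hs.1 : Icc 0 T ⊆ Ici 0)
      simpa only [add_assoc] using this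
  simp only [LinearMap.add_apply, inner_add_left (𝕜 := ℝ)] at h2
  rw [hE] at h1
  have h3 := mul_le_mul_of_nonneg_left (h1.trans h2) hw.le
  rw [← intervalIntegral.integral_const_mul] at h3
  refine h3.trans ?_
  have hdi : IntervalIntegrable (fun t => inner ℝ (u t) (a (u t) + S (f (u t)) + W (u t)))
      volume 0 T :=
    (huc.inner (hGc.comp_continuousOn huc)).intervalIntegrable_of_Icc hT.le
  have h4 : 16 * C * M * ((1 + w) * (energy u 0 - energy u T) + T * c) =
      ∫ t in (0 : ℝ)..T, 16 * C * M *
        ((1 + w) * inner ℝ (u t) (a (u t) + S (f (u t)) + W (u t)) + c) := by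
    rw [intervalIntegral.integral_const_mul, intervalIntegral.integral_add
      (hdi.const_mul (1 + w)) intervalIntegrable_const, intervalIntegral.integral_const_mul,
      hu.energy_sub hGc hT.le, intervalIntegral.integral_const, smul_eq_mul, sub_zero]
  rw [h4]
  refine intervalIntegral.integral_mono_on hT.le ?_ ?_ fun t _ => ?_
  · refine ContinuousOn.intervalIntegrable_of_Icc hT.le ?_
    exact continuousOn_const.mul (((continuousOn_const.mul
      (((hSc.comp_continuousOn huc).inner huc).add ((hWc.comp_continuousOn huc).inner huc))).add
      (continuousOn_const.mul (hpc.norm.pow 2))))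
  · exact ((hdi.const_mul (1 + w)).add intervalIntegrable_const).const_mul _
  · set v := u t
    rw [inner_add_right, inner_add_right, ha, zero_add, ← hW v v]
    have q1 := hS0 v
    have q2 := hS0 (f v)
    have q3 := hW0 v
    have e1 := norm_sq_le_mul_inner S hS hS0 hβ hSβ (f v)
    have e2 := norm_sq_le_mul_inner W hW hW0 hK hWK v
    have e3 : ‖S (f v) + W v‖ ^ 2 ≤ 2 * (‖S (f v)‖ ^ 2 + ‖W v‖ ^ 2) :=
      (pow_le_pow_left₀ (norm_nonneg _) (norm_add_le _ _) 2).trans add_sq_le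
    set x := inner ℝ (S v) v
    set y := inner ℝ (S (f v)) (f v)
    set z := inner ℝ (W v) v
    have e4 : ‖S (f v) + W v‖ ^ 2 ≤ 2 * ((β + K) * (y + z)) := by
      have := mul_nonneg hK q2
      have := mul_nonneg hβ q3
      linarith
    have e5 : 8 * (β + K) * T ^ 2 * ‖S (f v) + W v‖ ^ 2 ≤ 16 * (M - 1) * (y + z) := by
      refine (mul_le_mul_of_nonneg_left e4 (by positivity)).trans_eq ?_
      simp only [M]
      ring
    have hM : 1 ≤ M := le_add_of_nonneg_left (by positivity)
    have e6 : 2 * (x + z) + 8 * (β + K) * T ^ 2 * ‖S (f v) + W v‖ ^ 2 ≤ 16 * M * (x + y + z) := by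
      have := mul_le_mul_of_nonneg_right hM q1
      linarith
    have e7 : w * (x + y + z) ≤ C * ((1 + w) * (inner ℝ v (S (f v)) + z) + c) := by
      have a1 : w * z ≤ (1 + w) * z := by linarith
      have a2 : (1 + w) * z ≤ C * ((1 + w) * z) := le_mul_of_one_le_left (by positivity) hC
      linarith [hfw v]
    calc _ ≤ w * (16 * M * (x + y + z)) := mul_le_mul_of_nonneg_left e6 hw.le
      _ = 16 * M * (w * (x + y + z)) := by ring
      _ ≤ 16 * M * (C * ((1 + w) * (inner ℝ v (S (f v)) + z) + c)) :=
        mul_le_mul_of_nonneg_left e7 (by positivity)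
      _ = _ := by ring

/-- The observability constant is at most `T² N² + 1`, where `N` bounds the observation operator,
unless the space is trivial. -/
lemma observability_const_le [FiniteDimensional ℝ V] (a : V →ₗ[ℝ] V) {q : V → ℝ} (hq : Continuous q)
    (ha : ∀ v, inner ℝ v (a v) = 0) {N : ℝ} (hN : 0 ≤ N) (hqN : ∀ x, q x ≤ N * ‖x‖ ^ 2)
    {T CT : ℝ} (hT : 0 < T)
    (hobs : ∀ φ : ℝ → V, IsSolutionOn a univ φ →
      CT * energy φ 0 ≤ ∫ t in (0 : ℝ)..T, q (φ t)) {v : V} (hv : v ≠ 0) :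
    CT ≤ T ^ 2 * N ^ 2 + 1 := by
  obtain ⟨φ, hφ0, hφ⟩ := exists_isSolutionOn_linear a v
  have h1 := hobs φ hφ
  have hle : ∀ t ∈ Icc 0 T, q (φ t) ≤ N * ‖v‖ ^ 2 := fun t ht => by
    refine (hqN _).trans (mul_le_mul_of_nonneg_left ?_ hN)
    rw [← hφ0]
    exact pow_le_pow_left₀ (norm_nonneg _) (norm_le_of_energy_le
      (hφ.antitoneOn_energy convex_univ (fun x => (ha x).ge) trivial trivial ht.1)) 2
  have h2 : ∫ t in (0 : ℝ)..T, q (φ t) ≤ ∫ t in (0 : ℝ)..T, N * ‖v‖ ^ 2 :=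
    intervalIntegral.integral_mono_on hT.le
      ((hq.comp_continuousOn (hφ.continuousOn.mono (subset_univ _))).intervalIntegrable_of_Icc
        hT.le)
      intervalIntegrable_const hle
  rw [intervalIntegral.integral_const, smul_eq_mul, sub_zero] at h2
  have h3 : CT * (1 / 2) ≤ T * N := by
    refine le_of_mul_le_mul_right (a := ‖v‖ ^ 2) ?_ (by positivity)
    rw [energy, hφ0] at h1
    linarith
  nlinarith [sq_nonneg (T * N - 1)]

end Step

namespace IsDampingProfile

/-- Discrete comparison: sampled energies satisfying the weighted inequality for every weight decay
at least like the rate function. Where the bound could fail at step `k + 1`, the weight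
`w = 1 / ψ⁻¹((k + 2) δ)` makes `L(w)` the value of the rate there. -/
lemma energy_le_decayRate {g : ℝ → ℝ} {s₀ : ℝ} (hg : IsDampingProfile g s₀)
    {c M CT T b δ β : ℝ} (hc : 0 < c) (hM : 0 < M) (hCT : 0 < CT) (hδ : 0 ≤ δ)
    (hδ₁ : δ ≤ 1 / maxSlope g s₀) (hδ₂ : 2 * δ * (2 * (c * M * (1 + maxSlope g s₀))) ≤ CT)
    (hβ : 0 ≤ β) (hβ₁ : 2 * (c * M * (T * b)) ≤ CT * β) {E : ℕ → ℝ} (hE : ∀ k, 0 ≤ E k)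
    (hanti : ∀ k, E (k + 1) ≤ E k)
    (hstep : ∀ k, ∀ w > 0, w * (CT * E k) ≤
      c * M * ((1 + w) * (E k - E (k + 1)) + T * (b * conjH g s₀ w)))
    (h0 : E 0 ≤ β * decayRate g s₀ δ) (k : ℕ) :
    E k ≤ β * decayRate g s₀ ((k + 1) * δ) := by
  induction k with
  | zero => simpa using h0
  | succ k ih =>
    by_contra! hlt
    have hcast : ((k + 1 : ℕ) + 1 : ℝ) * δ = (k + 1) * δ + δ := by
      push_cast
      ring
    rw [hcast] at hlt
    set θ := psiInv g s₀ ((k + 1) * δ + δ)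
    set y := decayRate g s₀ ((k + 1) * δ + δ)
    have hθ := hg.one_div_mem (hg.le_psiInv ((k + 1) * δ + δ))
    set w := 1 / θ
    have hw : 0 < w := hθ.2.1
    have hwm : w ≤ maxSlope g s₀ := hθ.2.2
    have hy : y = conjH g s₀ w / w := rfl
    have hconj : conjH g s₀ w = w * y := by
      rw [hy]
      field_simp
    have h1 := hstep k w hw
    rw [hconj] at h1
    have hcM : 0 < c * M := by positivity
    -- the source term is absorbed
    have h2 : 2 * (c * M * (T * b)) * y ≤ CT * E k :=
      calc _ ≤ CT * β * y := mul_le_mul_of_nonneg_right hβ₁ (hg.decayRate_pos _).le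
        _ = CT * (β * y) := by ring
        _ ≤ CT * E k := mul_le_mul_of_nonneg_left (hlt.le.trans (hanti k)) hCT.le
    have h3 : w * (CT * E k) ≤ 2 * (c * M * (1 + w)) * (E k - E (k + 1)) := by
      have := mul_le_mul_of_nonneg_left h2 hw.le
      linarith
    have h4 : 2 * (c * M * (1 + w)) * (E k - E (k + 1)) ≤
        2 * (c * M * (1 + maxSlope g s₀)) * (E k - E (k + 1)) := by
      have : 0 ≤ E k - E (k + 1) := sub_nonneg.2 (hanti k)
      gcongr
    have hpos : 0 < 2 * (c * M * (1 + maxSlope g s₀)) := by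
      have := hg.maxSlope_pos
      positivity
    have h5 : 2 * δ * w * E k ≤ E k - E (k + 1) := by
      refine le_of_mul_le_mul_left ?_ hpos
      have := mul_le_mul_of_nonneg_right hδ₂ (mul_nonneg hw.le (hE k))
      linarith
    have h6 : E (k + 1) ≤ E k * (1 - 2 * δ * w) := by linarith
    have hEpos : 0 < E (k + 1) :=
      (mul_nonneg hβ (hg.decayRate_pos _).le).trans_lt hlt
    have h7 : 0 ≤ 1 - 2 * δ * w := by
      by_contra! h
      have := mul_nonpos_of_nonneg_of_nonpos (hE k) h.le
      linarith
    have h8 : E (k + 1) ≤ β * y :=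
      calc _ ≤ β * decayRate g s₀ ((k + 1) * δ) * (1 - 2 * δ * w) :=
            h6.trans (mul_le_mul_of_nonneg_right ih h7)
        _ = β * (decayRate g s₀ ((k + 1) * δ) * (1 - 2 * δ * w)) := by ring
        _ ≤ β * y := mul_le_mul_of_nonneg_left (hg.decayRate_add_ge _ hδ hδ₁) hβ
    linarith

end IsDampingProfile

/-! ### The semi-discretized equation -/

section Scheme

variable {X : Type*} [NormedAddCommGroup X] [InnerProductSpace ℝ X]
variable {Ω : Type*} [MeasurableSpace Ω] {μ : Measure Ω}

lemma rhoTilde_pulledBack {V : Type*} [NormedAddCommGroup V] [InnerProductSpace ℝ V]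
    [FiniteDimensional ℝ V] {A : X →ₗ.[ℝ] X} (F : X → X) (U : Lp ℝ 2 μ ≃ₗᵢ[ℝ] X)
    (P' : V →ₗ[ℝ] HalfSpace A) (u : V) :
    rhoTilde A F U P' (pulledBack U P' u) = pulledBack U P' (discreteF A F P' u) := by
  simp [rhoTilde, rhoMap, pulledBack, discreteF]

variable {V : ℝ → Type*} [∀ h, NormedAddCommGroup (V h)] [∀ h, InnerProductSpace ℝ (V h)]
  [∀ h, FiniteDimensional ℝ (V h)]
variable {g : ℝ → ℝ} {s₀ c₁ c₂ : ℝ} {A : X →ₗ.[ℝ] X} {B : X →L[ℝ] X} {F : X → X} {b : Ω → ℝ}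
  {U : Lp ℝ 2 μ ≃ₗᵢ[ℝ] X} {A' : HalfSpace A →ₗ[ℝ] NegHalfSpace A}
  {P' : ∀ h, V h →ₗ[ℝ] HalfSpace A} {W : ∀ h, V h →L[ℝ] V h} {h₀ h₁ σ K : ℝ}

namespace DiscreteSetting

lemma inner_discreteB_self_le (hd : DiscreteSetting g c₁ c₂ A B F U h₀ h₁ σ K P' W) {h : ℝ}
    (hh : h ∈ Ioo 0 h₀) (v : V h) :
    inner ℝ (discreteB A B (P' h) v) v ≤ ‖B‖ * ‖v‖ ^ 2 := by
  rw [inner_discreteB, hd.norm_eq h hh]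
  refine (real_inner_le_norm _ _).trans ?_
  rw [sq, ← mul_assoc]
  exact mul_le_mul_of_nonneg_right (B.le_opNorm _) (norm_nonneg _)

lemma norm_sample_le (hd : DiscreteSetting g c₁ c₂ A B F U h₀ h₁ σ K P' W) {h : ℝ}
    (hh : h ∈ Ioo 0 h₀) (x : X) : ‖sample A (P' h) x‖ ≤ ‖x‖ := by
  rcases (norm_nonneg (sample A (P' h) x)).eq_or_lt with h0 | h0
  · rw [← h0]
    exact norm_nonneg x
  · have h1 := real_inner_le_norm x (P' h (sample A (P' h) x) : X)
    rw [← inner_sample, real_inner_self_eq_norm_sq, ← hd.norm_eq h hh, sq] at h1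
    exact le_of_mul_le_mul_right h1 h0

lemma inner_viscosity_le (hd : DiscreteSetting g c₁ c₂ A B F U h₀ h₁ σ K P' W) {h : ℝ}
    (hh : h ∈ Ioo 0 h₀) (hh₁ : h ≤ h₁) (v : V h) :
    inner ℝ ((h ^ σ • W h) v) v ≤ K * ‖v‖ ^ 2 := by
  have hpos : 0 < h ^ σ := Real.rpow_pos_of_pos hh.1 σ
  have h1 := (real_inner_le_norm (W h v) v).trans
    (mul_le_mul_of_nonneg_right ((W h).le_opNorm v) (norm_nonneg v))
  have h2 := mul_le_mul_of_nonneg_right (hd.bounded_W h hh hh₁) (sq_nonneg ‖v‖)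
  have h3 := mul_le_mul_of_nonneg_left h1 hpos.le
  rw [smul_apply, real_inner_smul_left]
  linarith

end DiscreteSetting

variable [CompleteSpace X]

namespace ContinuousSetting

lemma inner_discreteB_eq_integral (hc : ContinuousSetting g c₁ c₂ A B F b U) {h : ℝ}
    (v w : V h) :
    inner ℝ (discreteB A B (P' h) v) w =
      ∫ x, b x * (pulledBack U (P' h) v x * pulledBack U (P' h) w x) ∂μ := by
  rw [inner_discreteB, ← inner_damping hc.mul_b, pulledBack, pulledBack, U.apply_symm_apply,
    U.apply_symm_apply]

lemma inner_discreteB_comm (hc : ContinuousSetting g c₁ c₂ A B F b U) {h : ℝ} (v w : V h) :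
    inner ℝ (discreteB A B (P' h) v) w = inner ℝ v (discreteB A B (P' h) w) := by
  rw [inner_discreteB, real_inner_comm (discreteB A B (P' h) w), inner_discreteB,
    hc.nonneg_B.inner_left_eq_inner_right, real_inner_comm]

lemma inner_discreteB_self_nonneg (hc : ContinuousSetting g c₁ c₂ A B F b U) {h : ℝ} (v : V h) :
    0 ≤ inner ℝ (discreteB A B (P' h) v) v := by
  rw [inner_discreteB]
  exact hc.nonneg_B.inner_nonneg_left _

end ContinuousSetting

namespace DiscreteSetting

lemma lipschitzOnWith_discreteF (hc : ContinuousSetting g c₁ c₂ A B F b U)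
    (hd : DiscreteSetting g c₁ c₂ A B F U h₀ h₁ σ K P' W) {h : ℝ}
    (hh : h ∈ Ioo 0 h₀) (R : ℝ) :
    ∃ C : NNReal, LipschitzOnWith C (discreteF A F (P' h)) (Metric.closedBall 0 R) := by
  obtain ⟨C, hC⟩ := hc.lipschitz_F R
  have hmem : ∀ u ∈ Metric.closedBall (0 : V h) R, (P' h u : X) ∈ Metric.closedBall (0 : X) R := by
    intro u hu
    rw [mem_closedBall_zero_iff] at hu ⊢
    rwa [← hd.norm_eq h hh]
  refine ⟨C, LipschitzOnWith.of_dist_le_mul fun u hu v hv => ?_⟩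
  have h1 := hC.dist_le_mul _ (hmem u hu) _ (hmem v hv)
  rw [dist_eq_norm, dist_eq_norm] at h1 ⊢
  have hsub : (P' h (u - v) : X) = P' h u - P' h v := by
    rw [map_sub]
    rfl
  rw [discreteF, discreteF, ← map_sub, hd.norm_eq h hh (u - v), hsub]
  exact (hd.norm_sample_le hh _).trans h1

lemma lipschitzOnWith_schemeField (hc : ContinuousSetting g c₁ c₂ A B F b U)
    (hd : DiscreteSetting g c₁ c₂ A B F U h₀ h₁ σ K P' W) {h : ℝ}
    (hh : h ∈ Ioo 0 h₀) (R : ℝ) :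
    ∃ C : NNReal, LipschitzOnWith C (schemeField A A' B F (P' h) (W h) σ h)
      (Metric.closedBall 0 R) := by
  obtain ⟨C, hC⟩ := lipschitzOnWith_discreteF hc hd hh R
  have h1 := (LinearMap.toContinuousLinearMap (discreteA A A' (P' h))).lipschitz
  have h2 := (LinearMap.toContinuousLinearMap (discreteB A B (P' h))).lipschitz
  have h3 := (h ^ σ • W h).lipschitz
  exact ⟨_, (h1.lipschitzOnWith.add (h2.comp_lipschitzOnWith hC)).add h3.lipschitzOnWith⟩

lemma inner_schemeField_nonneg (hc : ContinuousSetting g c₁ c₂ A B F b U)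
    (hA' : IsCanonicalExtension A A')
    (hd : DiscreteSetting g c₁ c₂ A B F U h₀ h₁ σ K P' W) {h : ℝ}
    (hh : h ∈ Ioo 0 h₀) (u : V h) :
    0 ≤ inner ℝ u (schemeField A A' B F (P' h) (W h) σ h u) := by
  have := hd.dissipative h hh u
  rw [schemeField, inner_add_right, inner_add_right,
    inner_discreteA_self hc.skewAdjoint hA', inner_smul_right, ← real_inner_comm u (W h u)]
  linarith

/-- The pointwise weighted inequality, integrated against `b dμ`. -/
lemma weighted_bound [IsProbabilityMeasure μ] (hc : ContinuousSetting g c₁ c₂ A B F b U)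
    (hd : DiscreteSetting g c₁ c₂ A B F U h₀ h₁ σ K P' W) {C : ℝ} (hC : 0 ≤ C)
    (hbound : ∀ w x y : ℝ, 0 < w → 0 ≤ x * y →
      (|x| ≤ 1 → c₁ * g |x| ≤ |y| ∧ |y| ≤ c₂ * Function.invFun g |x|) →
      (1 ≤ |x| → c₁ * |x| ≤ |y| ∧ |y| ≤ c₂ * |x|) →
      w * (x ^ 2 + y ^ 2) ≤ C * ((1 + w) * (x * y) + conjH g s₀ w))
    (hg : IsDampingProfile g s₀) {h : ℝ} (hh : h ∈ Ioo 0 h₀) {w : ℝ} (hw : 0 < w) (v : V h) :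
    w * (inner ℝ (discreteB A B (P' h) v) v +
        inner ℝ (discreteB A B (P' h) (discreteF A F (P' h) v)) (discreteF A F (P' h) v)) ≤
      C * ((1 + w) * inner ℝ v (discreteB A B (P' h) (discreteF A F (P' h) v)) +
        ‖B‖ * conjH g s₀ w) := by
  have hsign := hd.sign h hh v
  have hgrowth := hd.growth h hh v
  rw [rhoTilde_pulledBack] at hsign hgrowth
  rw [← hc.inner_discreteB_comm, hc.inner_discreteB_eq_integral, hc.inner_discreteB_eq_integral,
    hc.inner_discreteB_eq_integral]
  set f := pulledBack U (P' h) v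
  set r := pulledBack U (P' h) (discreteF A F (P' h) v)
  have iff' := integrable_damping hc.mul_b f f
  have irr := integrable_damping hc.mul_b r r
  have ifr := integrable_damping hc.mul_b f r
  obtain ⟨ib, hib⟩ := integral_damping_le hc.mul_b
  rw [← integral_add iff' irr, ← integral_const_mul]
  have hle : ∫ x, w * (b x * (f x * f x) + b x * (r x * r x)) ∂μ ≤
      ∫ x, C * ((1 + w) * (b x * (f x * r x)) + conjH g s₀ w * b x) ∂μ := by
    refine integral_mono_ae ((iff'.add irr).const_mul w)
      (((ifr.const_mul (1 + w)).add (ib.const_mul _)).const_mul C) ?_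
    filter_upwards [hsign, hgrowth] with x h1 h2
    have := mul_le_mul_of_nonneg_left (hbound w (f x) (r x) hw h1 h2.1 h2.2) (hc.nonneg_b x)
    linarith
  refine hle.trans ?_
  rw [integral_const_mul, integral_add (ifr.const_mul (1 + w)) (ib.const_mul _),
    integral_const_mul, integral_const_mul]
  refine mul_le_mul_of_nonneg_left (add_le_add_right ?_ _) hC
  rw [mul_comm]
  exact mul_le_mul_of_nonneg_right hib (hg.conjH_nonneg w)

theorem exists_unique_solution (hc : ContinuousSetting g c₁ c₂ A B F b U)
    (hA' : IsCanonicalExtension A A')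
    (hd : DiscreteSetting g c₁ c₂ A B F U h₀ h₁ σ K P' W) {h : ℝ}
    (hh : h ∈ Ioo 0 h₀) (u₀ : V h) :
    ∃ u : ℝ → V h, u 0 = u₀ ∧
      IsSolutionOn (schemeField A A' B F (P' h) (W h) σ h) (Ici 0) u ∧
      ∀ τ > 0, ∀ v : ℝ → V h, v 0 = u₀ →
        IsSolutionOn (schemeField A A' B F (P' h) (W h) σ h) (Ico 0 τ) v →
        EqOn v u (Ico 0 τ) := by
  have hG := inner_schemeField_nonneg hc hA' hd hh
  have hL := lipschitzOnWith_schemeField (A' := A') hc hd hh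
  obtain ⟨u, hu0, hu⟩ := exists_isSolutionOn_Ici hG hL u₀
  exact ⟨u, hu0, hu, fun τ _ v hv0 hv =>
    hv.eqOn_Ico hG hL (hu.mono fun t ht => ht.1) (hv0.trans hu0.symm)⟩

/-- The decay estimate, for constants that satisfy the smallness conditions of the discrete
comparison. -/
theorem energy_le [IsProbabilityMeasure μ] (hg : IsDampingProfile g s₀)
    (hc : ContinuousSetting g c₁ c₂ A B F b U) (hA' : IsCanonicalExtension A A')
    (hd : DiscreteSetting g c₁ c₂ A B F U h₀ h₁ σ K P' W) {C : ℝ} (hC : 1 ≤ C)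
    (hbound : ∀ w x y : ℝ, 0 < w → 0 ≤ x * y →
      (|x| ≤ 1 → c₁ * g |x| ≤ |y| ∧ |y| ≤ c₂ * Function.invFun g |x|) →
      (1 ≤ |x| → c₁ * |x| ≤ |y| ∧ |y| ≤ c₂ * |x|) →
      w * (x ^ 2 + y ^ 2) ≤ C * ((1 + w) * (x * y) + conjH g s₀ w))
    {T CT κ γ β : ℝ} (hT : 0 < T) (hCT : 0 < CT) (hobs : UniformObservability A A' B h₀ σ T CT P' W)
    (hκ : 0 < κ) (hκ₁ : κ ≤ 1 / IsDampingProfile.maxSlope g s₀)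
    (hκ₂ : κ * (4 * (16 * C * (1 + IsDampingProfile.maxSlope g s₀))) ≤ 1)
    (hγ : γ = κ * (CT / (T * (T ^ 2 * (‖B‖ + K) ^ 2 + 1))))
    (hβ₁ : 2 * (16 * C) * κ * (‖B‖ / γ) ≤ β) {h : ℝ} (hh : h ∈ Ioo 0 h₀) (hh₁ : h ≤ h₁)
    {u : ℝ → V h} (hu : IsSolutionOn (schemeField A A' B F (P' h) (W h) σ h) (Ici 0) u)
    (hβ₂ : energy u 0 ≤ β * rateL g s₀ (IsDampingProfile.maxSlope g s₀)) {t : ℝ} (ht : 0 < t) :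
    energy u t ≤ β * IsDampingProfile.decayRate g s₀ (γ * t) := by
  have hpos : 0 < h ^ σ := Real.rpow_pos_of_pos hh.1 σ
  have hK : 0 ≤ K :=
    (mul_nonneg hpos.le (norm_nonneg (W h))).trans (hd.bounded_W h hh hh₁)
  set M := T ^ 2 * (‖B‖ + K) ^ 2 + 1
  have hM : 0 < M := by positivity
  have hγ0 : 0 < γ := by
    rw [hγ]
    positivity
  have hβ : 0 ≤ β := le_trans (by positivity) hβ₁
  have hG := inner_schemeField_nonneg hc hA' hd hh
  have hanti := hu.antitoneOn_energy (convex_Ici 0) hG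
  rcases (energy_nonneg u 0).eq_or_lt with h0 | h0
  · refine (hanti self_mem_Ici ht.le ht.le).trans (h0.symm.le.trans ?_)
    exact mul_nonneg hβ (hg.decayRate_pos _).le
  -- the data of the equation in `V h`
  have ha := inner_discreteA_self hc.skewAdjoint hA' (P' h)
  set S := discreteB A B (P' h)
  let Q : V h →ₗ[ℝ] V h := (h ^ σ • W h : V h →L[ℝ] V h)
  have hQ : ∀ v, Q v = h ^ σ • W h v := fun v => rfl
  have hQs : ∀ x y, inner ℝ (Q x) y = inner ℝ x (Q y) := fun x y => by
    rw [hQ, hQ, real_inner_smul_left, real_inner_smul_right,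
      (hd.nonneg_W h hh).inner_left_eq_inner_right]
  have hQ0 : ∀ x, 0 ≤ inner ℝ (Q x) x := fun x => by
    rw [hQ, real_inner_smul_left]
    exact mul_nonneg hpos.le ((hd.nonneg_W h hh).inner_nonneg_left x)
  have hQK : ∀ x, inner ℝ (Q x) x ≤ K * ‖x‖ ^ 2 := hd.inner_viscosity_le hh hh₁
  have hSB : ∀ x, inner ℝ (S x) x ≤ ‖B‖ * ‖x‖ ^ 2 := hd.inner_discreteB_self_le hh
  have hobs' : ∀ φ : ℝ → V h, IsSolutionOn (discreteA A A' (P' h)) univ φ →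
      CT * energy φ 0 ≤ ∫ t in (0 : ℝ)..T, (inner ℝ (S (φ t)) (φ t) + inner ℝ (Q (φ t)) (φ t)) := by
    intro φ hφ
    simp only [hQ, real_inner_smul_left]
    exact hobs h hh φ hφ
  have hCTM : CT ≤ M := by
    have hSc : Continuous S := S.continuous_of_finiteDimensional
    have hQc : Continuous Q := Q.continuous_of_finiteDimensional
    refine observability_const_le _ (q := fun x => inner ℝ (S x) x + inner ℝ (Q x) x)
      (by fun_prop) ha (by positivity) (fun x => ?_) hT hobs' (v := u 0) fun h => ?_
    · linarith [hSB x, hQK x]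
    · simp [energy, h] at h0
  -- the energies at the multiples of `T`
  have hδ : γ * T * M = κ * CT := by
    rw [hγ]
    field_simp
  have hδκ : γ * T ≤ κ := by
    refine le_of_mul_le_mul_right ?_ hM
    rw [hδ]
    exact mul_le_mul_of_nonneg_left hCTM hκ.le
  have hkT : ∀ k : ℕ, (0 : ℝ) ≤ k * T := fun k => by positivity
  have hEk := hg.energy_le_decayRate (c := 16 * C) (M := M) (CT := CT) (T := T) (b := ‖B‖)
    (δ := γ * T) (β := β) (E := fun k => energy u (k * T)) (by positivity) hM hCT (by positivity)
    (hδκ.trans hκ₁)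
    (by
      have := mul_le_mul_of_nonneg_right hκ₂ hCT.le
      calc _ = 4 * (16 * C * (1 + IsDampingProfile.maxSlope g s₀)) * (γ * T * M) := by ring
        _ = κ * (4 * (16 * C * (1 + IsDampingProfile.maxSlope g s₀))) * CT := by
          rw [hδ]
          ring
        _ ≤ CT := by linarith)
    hβ
    (by
      have := mul_le_mul_of_nonneg_left hβ₁ hCT.le
      refine le_trans (le_of_eq ?_) this
      rw [hγ]
      field_simp)
    (fun k => energy_nonneg u _)
    (fun k => hanti (hkT k) (hkT (k + 1)) (by push_cast; linarith))
    (fun k w hw => by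
      have := weighted_energy_step (discreteA A A' (P' h)) S Q (f := discreteF A F (P' h)) ha
        hc.inner_discreteB_comm hc.inner_discreteB_self_nonneg hQs hQ0 (norm_nonneg B) hK hSB hQK
        (continuous_of_lipschitzOn_balls (lipschitzOnWith_discreteF hc hd hh)) hT hobs'
        (u := fun t => u (k * T + t)) (hu.shift (hkT k)) hC hw
        (weighted_bound hc hd (by linarith) hbound hg hh hw)
      have e0 : energy (fun t => u (k * T + t)) 0 = energy u (k * T) := by simp [energy]
      have e1 : energy (fun t => u (k * T + t)) T = energy u ((k + 1 : ℕ) * T) := by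
        simp only [energy]
        push_cast
        rw [add_one_mul]
      rwa [e0, e1] at this)
    (by
      have : IsDampingProfile.decayRate g s₀ (γ * T) =
          rateL g s₀ (IsDampingProfile.maxSlope g s₀) := by
        rw [IsDampingProfile.decayRate, hg.psiInv_eq_left (hδκ.trans hκ₁), one_div_one_div]
      rw [this]
      simpa using hβ₂)
    ⌊t / T⌋₊
  have hfl : ⌊t / T⌋₊ * T ≤ t := by
    rw [← le_div_iff₀ hT]
    exact Nat.floor_le (by positivity)
  have hfl' : t ≤ (⌊t / T⌋₊ + 1) * T := by
    rw [← div_le_iff₀ hT]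
    exact (Nat.lt_floor_add_one _).le
  refine (hanti (hkT _) ht.le hfl).trans (hEk.trans (mul_le_mul_of_nonneg_left ?_ hβ))
  refine hg.decayRate_antitone ?_
  have := mul_le_mul_of_nonneg_left hfl' hγ0.le
  linarith

end DiscreteSetting

end Scheme

theorem theorem2 (g : ℝ → ℝ) (s₀ c₁ c₂ : ℝ) (hg : IsDampingProfile g s₀)
    (hc₁ : 0 < c₁) (hc₂ : 0 < c₂) :
    ∃ C κ₁ κ₂ κ₃ : ℝ, 0 < C ∧ 0 < κ₁ ∧ 0 < κ₂ ∧ 0 < κ₃ ∧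
      ∀ (X : Type*) [NormedAddCommGroup X] [InnerProductSpace ℝ X] [CompleteSpace X]
        (Ω : Type*) [MeasurableSpace Ω] (μ : Measure Ω) [IsProbabilityMeasure μ]
        (A : X →ₗ.[ℝ] X) (B : X →L[ℝ] X) (F : X → X) (b : Ω → ℝ) (U : Lp ℝ 2 μ ≃ₗᵢ[ℝ] X)
        (_ : ContinuousSetting g c₁ c₂ A B F b U)
        (A' : HalfSpace A →ₗ[ℝ] NegHalfSpace A) (_ : IsCanonicalExtension A A')
        (V : ℝ → Type*) [∀ h, NormedAddCommGroup (V h)] [∀ h, InnerProductSpace ℝ (V h)]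
        [∀ h, FiniteDimensional ℝ (V h)]
        (P' : ∀ h, V h →ₗ[ℝ] HalfSpace A) (W : ∀ h, V h →L[ℝ] V h) (h₀ h₁ σ K : ℝ)
        (_ : DiscreteSetting g c₁ c₂ A B F U h₀ h₁ σ K P' W)
        (T CT γ₁ γ₂ γ₃ : ℝ) (_ : 0 < T) (_ : 0 < CT)
        (_ : UniformObservability A A' B h₀ σ T CT P' W)
        (_ : γ₂ = κ₂ * (CT / (T * (T ^ 2 * (‖B‖ + K) ^ 2 + 1))))
        (_ : γ₁ = κ₁ * (‖B‖ / γ₂)) (_ : γ₃ = κ₃ / γ₂),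
        -- the solutions are well defined on the whole half-line
        (∀ h ∈ Ioo 0 h₀, ∀ u₀ : V h, ∃ u : ℝ → V h, u 0 = u₀ ∧
          IsSolutionOn (schemeField A A' B F (P' h) (W h) σ h) (Ici 0) u ∧
          ∀ τ > 0, ∀ v : ℝ → V h, v 0 = u₀ →
            IsSolutionOn (schemeField A A' B F (P' h) (W h) σ h) (Ico 0 τ) v →
            EqOn v u (Ico 0 τ)) ∧
        -- uniform decay of the energy
        (∀ h ∈ Ioo 0 h₀, h ≤ h₁ → ∀ u : ℝ → V h,
          IsSolutionOn (schemeField A A' B F (P' h) (W h) σ h) (Ici 0) u → ∀ t > 0,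
            energy u t ≤
              C * max 1 T * max γ₁ (energy u 0) * rateL g s₀ (1 / psiInv g s₀ (γ₂ * t))) ∧
        -- simplified decay rate
        (limsup (LambdaH g) (𝓝[>] 0) < 1 →
          ∀ h ∈ Ioo 0 h₀, h ≤ h₁ → ∀ u : ℝ → V h,
            IsSolutionOn (schemeField A A' B F (P' h) (W h) σ h) (Ici 0) u → ∀ t > 0,
              energy u t ≤
                C * max 1 T * max γ₁ (energy u 0) * invDerivH g s₀ (γ₃ / t)) := by
  obtain ⟨C₀, hC₀, hbound⟩ := hg.exists_weighted_bound hc₁ hc₂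
  set m := IsDampingProfile.maxSlope g s₀
  have hm : 0 < m := hg.maxSlope_pos
  have hL : 0 < rateL g s₀ m := hg.rateL_pos ⟨hm, le_rfl⟩
  set κ := min (1 / m) (1 / (4 * (16 * C₀ * (1 + m))))
  have hden : 0 < 4 * (16 * C₀ * (1 + m)) := by positivity
  have hκ : 0 < κ := lt_min (by positivity) (by positivity)
  have hκ₂ : κ * (4 * (16 * C₀ * (1 + m))) ≤ 1 := by
    rw [← le_div_iff₀ hden]
    exact min_le_right _ _
  -- `q` bounds `Λ_H` if the upper limit of `Λ_H` at `0` is smaller than `1`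
  obtain ⟨q, hq, hΛ⟩ : ∃ q < 1, limsup (LambdaH g) (𝓝[>] 0) < 1 →
      ∀ s ∈ Ioc 0 (s₀ ^ 2), LambdaH g s ≤ q := by
    by_cases h : limsup (LambdaH g) (𝓝[>] 0) < 1
    · obtain ⟨q, hq, hΛ⟩ := hg.exists_LambdaH_le h
      exact ⟨q, hq, fun _ => hΛ⟩
    · exact ⟨0, one_pos, fun h' => absurd h' h⟩
  set C := max 1 (1 / rateL g s₀ m)
  have hC : 1 ≤ C := le_max_left _ _
  refine ⟨C, 2 * (16 * C₀) * κ, κ, 1 / (1 - q), by positivity, by positivity, hκ,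
    one_div_pos.2 (by linarith), ?_⟩
  intro X _ _ _ Ω _ μ _ A B F b U hc A' hA' V _ _ _ P' W h₀ h₁ σ K hd T CT γ₁ γ₂ γ₃ hT hCT hobs
    hγ₂ hγ₁ hγ₃
  have hdecay : ∀ h ∈ Ioo 0 h₀, h ≤ h₁ → ∀ u : ℝ → V h,
      IsSolutionOn (schemeField A A' B F (P' h) (W h) σ h) (Ici 0) u → ∀ t > 0,
      energy u t ≤ C * max 1 T * max γ₁ (energy u 0) *
        IsDampingProfile.decayRate g s₀ (γ₂ * t) := by
    intro h hh hh₁ u hu t ht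
    have hE := energy_nonneg u 0
    have hm0 : 0 ≤ max γ₁ (energy u 0) := hE.trans (le_max_right _ _)
    have hCm : C * max γ₁ (energy u 0) ≤ C * max 1 T * max γ₁ (energy u 0) :=
      mul_le_mul_of_nonneg_right (le_mul_of_one_le_right (by positivity) (le_max_left _ _)) hm0
    refine hd.energy_le hg hc hA' hC₀ hbound hT hCT hobs hκ (min_le_left _ _) hκ₂ hγ₂ ?_ hh hh₁ hu
      ?_ ht
    · rw [← hγ₁]
      exact (le_max_left γ₁ (energy u 0)).trans ((le_mul_of_one_le_left hm0 hC).trans hCm)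
    · refine le_trans ?_ (mul_le_mul_of_nonneg_right hCm hL.le)
      have h1 : 1 ≤ C * rateL g s₀ m := by
        rw [← div_le_iff₀ hL]
        exact le_max_right _ _
      calc energy u 0 ≤ max γ₁ (energy u 0) := le_max_right _ _
        _ ≤ max γ₁ (energy u 0) * (C * rateL g s₀ m) := le_mul_of_one_le_right hm0 h1
        _ = _ := by ring
  refine ⟨fun h hh u₀ => hd.exists_unique_solution hc hA' hh u₀, hdecay,
    fun hlim h hh hh₁ u hu t ht => ?_⟩
  have hm0 : 0 ≤ max γ₁ (energy u 0) := (energy_nonneg u 0).trans (le_max_right _ _)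
  refine (hdecay h hh hh₁ u hu t ht).trans (mul_le_mul_of_nonneg_left ?_ (by positivity))
  have hK : 0 ≤ T ^ 2 * (‖B‖ + K) ^ 2 := by positivity
  have hγ : 0 < γ₂ := by
    rw [hγ₂]
    positivity
  have := hg.decayRate_le_invDerivH hq (hΛ hlim) (mul_pos hγ ht)
  rwa [hγ₃, show 1 / (1 - q) / γ₂ / t = 1 / ((1 - q) * (γ₂ * t)) by
    rw [div_div, div_div]]
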